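/- Consider the following game $G(n;w)$ with $n\ge 2$ agents and a parameter $w>1$. Time is discrete; initially all agents are outside a queue, which is empty. In every time step, each agent outside the queue decides, possibly randomly and independently of the others, whether to enter; the entering agents are appended to the end of the queue in uniformly random order; then, if the queue is not empty, its first agent is processed and leaves at no cost for this step, every agent remaining in the queue pays $w$, and every agent still outside pays $1$. The cost of an agent is his expected total payment, in $[0,\infty]$. An anonymous stationary strategy specifies, for each $m\ge 1$ and $k\ge 0$, a probability $q_{m,k}\in[0,1]$ of entering when $m$ agents are outside and $k$ agents are in the queue at the beginning of the step. A symmetric equilibrium is an anonymous stationary strategy $S$ such that, when all agents play $S$, no agent can lower his cost by deviating unilaterally to another anonymous stationary strategy. Let $C_{n,w}(S)$ be the social cost (the sum of the costs of the agents) when all agents play $S$, and let $OPT(n,w)=\inf_S C_{n,w}(S)$, the infimum over all anonymous stationary strategies $S$. **Theorem.** (a) There is a constant $K$ such that for every $n\ge 2$ there is $w^n$ such that for every $w>w^n$ we have $0<OPT(n,w)<\infty$, and every symmetric equilibrium $S$ satisfies $C_{n,w}(S)<\infty$ and $$\left|\frac{C_{n,w}(S)}{OPT(n,w)}-\frac{3}{2\sqrt2}\right|\le\frac{K}{\sqrt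 n}.$$ (b) For every $\delta>0$ there is $n_0$ such that for every $n>n_0$ there is $w^n$ such that for every $w>w^n$ we have $0<OPT(n,w)<\infty$, and every symmetric equilibrium $S$ satisfies $C_{n,w}(S)<\infty$ and $$(1-\delta)\,\frac{3}{2\sqrt2}\le\frac{C_{n,w}(S)}{OPT(n,w)}\le(1+\delta)\,\frac{3}{2\sqrt2}.$$ -/

import Mathlib

/-! A queueing game with `n` agents and discrete time.  In every time step each agent outside the
queue decides (possibly randomly) whether to enter; the entering agents are appended to the queue
in uniformly random order; the first agent of the queue, if any, is processed; every agent left in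
the queue pays `w` and every agent still outside pays `1`. -/

open scoped ENNReal

noncomputable section

namespace QueueGame

/-- The situation at the beginning of a time step: the agents that are still outside the queue, and
the agents in the queue (head first). -/
structure State (n : ℕ) where
  outside : Finset (Fin n)
  queue : List (Fin n)

/-- The initial state: everybody is outside and the queue is empty. -/
def State.initial (n : ℕ) : State n := ⟨Finset.univ, []⟩

/-- The state after one time step in which the agents in `E` enter, in the order `l`. -/
def State.next {n : ℕ} (s : State n) (E : Finset (Fin n)) (l : List (Fin n)) : State n :=
  ⟨s.outside \ E, (s.queue ++ l).tail⟩

/-- The cost of agent `i` in a time step in which the agents in `E` enter, in the order `l`. -/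
def State.stepCost {n : ℕ} (w : ℝ) (s : State n) (E : Finset (Fin n)) (l : List (Fin n))
    (i : Fin n) : ℝ :=
  if i ∈ s.outside \ E then 1 else if i ∈ (s.queue ++ l).tail then w else 0

/-- An anonymous stationary strategy: `S m k` is the probability of entering the queue in a time
step at whose beginning `m` agents are outside (including the agent who decides) and `k` agents are
in the queue. -/
abbrev Strategy := ℕ → ℕ → unitInterval

/-- A profile of anonymous stationary strategies, one for each agent. -/
abbrev Profile (n : ℕ) := Fin n → Strategy

/-- The symmetric profile in which every agent plays `S`. -/
def symmetric (n : ℕ) (S : Strategy) : Profile n := fun _ => S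

/-- The probability that agent `i`, if outside, enters in state `s`. -/
def enterProb {n : ℕ} (P : Profile n) (s : State n) (i : Fin n) : ℝ :=
  (P i s.outside.card s.queue.length : ℝ)

/-- The probability that in state `s` the set of agents who enter is exactly `E ⊆ s.outside`; the
agents randomize independently. -/
def entrySetProb {n : ℕ} (P : Profile n) (s : State n) (E : Finset (Fin n)) : ℝ :=
  (∏ i ∈ E, enterProb P s i) * ∏ i ∈ s.outside \ E, (1 - enterProb P s i)

/-- The expected cost of agent `i` during the first `T` time steps, starting in state `s`.
The set `E.val.lists.toFinset` consists of all orderings of the elements of `E`, and `Finset.expect` is the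
average over it. -/
def costUpTo {n : ℕ} (P : Profile n) (w : ℝ) : ℕ → State n → Fin n → ℝ
  | 0, _, _ => 0
  | T + 1, s, i => ∑ E ∈ s.outside.powerset, entrySetProb P s E *
      Finset.expect E.val.lists.toFinset fun l => s.stepCost w E l i + costUpTo P w T (s.next E l) i

/-- The expected total cost of agent `i`, possibly infinite: the limit of the increasing sequence
of the expected costs during the first `T` time steps. -/
def cost {n : ℕ} (P : Profile n) (w : ℝ) (i : Fin n) : ℝ≥0∞ :=
  ⨆ T : ℕ, ENNReal.ofReal (costUpTo P w T (State.initial n) i)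

/-- The social cost: the sum of the expected costs of the agents. -/
def socialCost {n : ℕ} (P : Profile n) (w : ℝ) : ℝ≥0∞ := ∑ i, cost P w i

/-- If all agents play `S`, no agent can decrease his expected cost by a unilateral deviation to
another anonymous stationary strategy. -/
def IsSymmetricEquilibrium (n : ℕ) (w : ℝ) (S : Strategy) : Prop :=
  ∀ (i : Fin n) (S' : Strategy),
    cost (symmetric n S) w i ≤ cost (Function.update (symmetric n S) i S') w i

/-- The optimal social cost among symmetric profiles of anonymous stationary strategies. -/
def OPT (n : ℕ) (w : ℝ) : ℝ≥0∞ := ⨅ S : Strategy, socialCost (symmetric n S) w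

end QueueGame

end

/-!
The game is reduced to a Markov chain seen by one agent: `M` others are outside and `k` agents are
in the queue. Since an agent who enters has half of the other entrants in front of him on average
(`expect_idxOf`), his entering cost is `w * (k + M * q / 2)` when each of the others enters with
probability `q`. So his expected cost obeys a one-step recursion (`bellman`), and the cost in the
game is the value `chainValue` of that recursion (`cost_deviation`).

For large `w`, consider the states with empty queue. Entry probabilities are of order `1 / √w`, so
that simultaneous entries have probability of order `1 / w`, and what follows them contributes
nothing to leading order.

*Equilibria.* The best cost of a deviator (`optValue`) satisfies the optimality equation
`optValue_eq_min` and is `O(√w)`. In an equilibrium this cost is attained in every state with empty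
queue, and there the agents are indifferent between entering and staying outside
(`indifference_of_chainValue_eq`). If `c` and `c'` are the costs, in units of `√w`, with `M` and
`M - 1` others outside, entering costs `c = M * q * √w / 2`, and staying outside costs
`1 / (M * q * √w) + c'`; hence `c * (c - c') = 1 / 2`, and `c² ∼ M`
(`exists_abs_optValue_sub_le`, `abs_equilibriumCoeff_sub_sqrt_le`). The social cost is about
`n ^ (3 / 2) * √w`.

*The optimum.* With `j + 1` agents outside, the expected cost until the next entry is about
`1 / q + j * q * w / 2`, which is at least `√(2 * j * w)`, with equality for `q = √(2 / (j * w))`.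
Summing over `j < n` gives an optimum of about `√2 * (2 / 3) * n ^ (3 / 2) * √w`
(`exists_le_chainValue`, `chainValue_goodStrategy_le`, `optCoeff_bounds`).

The ratio is `3 / (2 * √2)`. For fixed `n` all errors in `w` are bounded, hence negligible against
`√w`; the remaining error in `n` is `O(1 / √n)` (`abs_coeff_ratio_sub_le`).
-/

noncomputable section

namespace QueueGame

/-! ### Binomial weights -/

/-- The probability that exactly `e` of `M` agents enter, if each does so with probability `q`. -/
def binomialWeight (M : ℕ) (q : ℝ) (e : ℕ) : ℝ := M.choose e * q ^ e * (1 - q) ^ (M - e)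

lemma binomialWeight_eq_eval (M : ℕ) (q : ℝ) (e : ℕ) :
    binomialWeight M q e = (bernsteinPolynomial ℝ M e).eval q := by
  simp [binomialWeight, bernsteinPolynomial]

lemma binomialWeight_nonneg {M : ℕ} {q : ℝ} (h0 : 0 ≤ q) (h1 : q ≤ 1) (e : ℕ) :
    0 ≤ binomialWeight M q e := by
  have : 0 ≤ 1 - q := by linarith
  unfold binomialWeight
  positivity

@[simp] lemma binomialWeight_zero_right (M : ℕ) (q : ℝ) : binomialWeight M q 0 = (1 - q) ^ M := by
  simp [binomialWeight]

lemma binomialWeight_one_right (M : ℕ) (q : ℝ) :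
    binomialWeight M q 1 = M * q * (1 - q) ^ (M - 1) := by
  simp [binomialWeight]

lemma sum_binomialWeight (M : ℕ) (q : ℝ) :
    ∑ e ∈ Finset.range (M + 1), binomialWeight M q e = 1 := by
  have h := congrArg (Polynomial.eval q) (bernsteinPolynomial.sum ℝ M)
  simpa [Polynomial.eval_finsetSum, binomialWeight_eq_eval] using h

lemma sum_binomialWeight_mul (M : ℕ) (q : ℝ) :
    ∑ e ∈ Finset.range (M + 1), binomialWeight M q e * e = M * q := by
  have h := congrArg (Polynomial.eval q) (bernsteinPolynomial.sum_smul ℝ M)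
  simpa [Polynomial.eval_finsetSum, binomialWeight_eq_eval, mul_comm] using h

lemma sum_binomialWeight_mul_mul_sub_one (M : ℕ) (q : ℝ) :
    ∑ e ∈ Finset.range (M + 1), binomialWeight M q e * (e * (e - 1)) = M * (M - 1) * q ^ 2 := by
  have h := congrArg (Polynomial.eval q) (bernsteinPolynomial.sum_mul_smul ℝ M)
  have hc : ∀ e : ℕ, ((e * (e - 1) : ℕ) : ℝ) = e * (e - 1) := by
    intro e
    cases e <;> simp
  simp only [Polynomial.eval_finsetSum, nsmul_eq_mul, Polynomial.eval_mul, Polynomial.eval_natCast,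
    Polynomial.eval_pow, Polynomial.eval_X, hc] at h
  rw [← h]
  refine Finset.sum_congr rfl fun e _ => ?_
  rw [binomialWeight_eq_eval, mul_comm]

/-! ### Orders of the entering agents -/

/-- The set of all orderings of the agents in `E`. -/
abbrev orders {n : ℕ} (E : Finset (Fin n)) : Finset (List (Fin n)) := E.val.lists.toFinset

section Orders

variable {n : ℕ} {E : Finset (Fin n)} {l : List (Fin n)} {i : Fin n}

lemma mem_orders : l ∈ orders E ↔ (l : Multiset (Fin n)) = E.val := by
  rw [Multiset.mem_toFinset, Multiset.mem_lists_iff]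
  exact eq_comm

lemma orders_nonempty (E : Finset (Fin n)) : (orders E).Nonempty :=
  ⟨E.toList, by rw [mem_orders, Finset.coe_toList]⟩

lemma mem_of_mem_orders (h : l ∈ orders E) : i ∈ l ↔ i ∈ E := by
  rw [← Multiset.mem_coe, mem_orders.1 h, Finset.mem_val]

lemma nodup_of_mem_orders (h : l ∈ orders E) : l.Nodup := by
  rw [← Multiset.coe_nodup, mem_orders.1 h]
  exact E.nodup

lemma length_of_mem_orders (h : l ∈ orders E) : l.length = E.card := by
  rw [← Multiset.coe_card, mem_orders.1 h, Finset.card_val]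

lemma reverse_mem_orders (h : l ∈ orders E) : l.reverse ∈ orders E := by
  rw [mem_orders, Multiset.coe_reverse]
  exact mem_orders.1 h

lemma idxOf_add_idxOf_reverse {l : List (Fin n)} (hl : l.Nodup) (hi : i ∈ l) :
    l.idxOf i + l.reverse.idxOf i + 1 = l.length := by
  induction l with
  | nil => simp at hi
  | cons a l ih =>
    rw [List.nodup_cons] at hl
    rw [List.reverse_cons]
    by_cases h : a = i
    · subst h
      rw [List.idxOf_append_of_notMem (by simpa using hl.1)]
      simp
    · have hil : i ∈ l := by
        rcases List.mem_cons.1 hi with h' | h'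
        · exact absurd h'.symm h
        · exact h'
      rw [List.idxOf_append_of_mem (by simpa using hil), List.idxOf_cons_ne _ h, List.length_cons]
      have := ih hl.2 hil
      omega

/-- In a uniformly random order an agent is preceded, on average, by half of the others:
reversing the order exchanges those before and those after him. -/
lemma expect_idxOf (hi : i ∈ E) :
    Finset.expect (orders E) (fun l => (l.idxOf i : ℝ)) = ((E.card : ℝ) - 1) / 2 := by
  have hrev : Finset.expect (orders E) (fun l => (l.idxOf i : ℝ))
      = Finset.expect (orders E) (fun l => (l.reverse.idxOf i : ℝ)) := by
    refine Finset.expect_bij (fun l _ => l.reverse) (fun l h => reverse_mem_orders h) ?_ ?_ ?_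
    · intro l _
      rw [List.reverse_reverse]
    · intro l₁ _ l₂ _ h
      exact List.reverse_injective h
    · intro l h
      exact ⟨l.reverse, reverse_mem_orders h, List.reverse_reverse l⟩
  have hsum : Finset.expect (orders E) (fun l => (l.idxOf i : ℝ) + (l.reverse.idxOf i : ℝ))
      = (E.card : ℝ) - 1 := by
    rw [← Finset.expect_const (orders_nonempty E) ((E.card : ℝ) - 1)]
    refine Finset.expect_congr rfl fun l h => ?_
    have := idxOf_add_idxOf_reverse (nodup_of_mem_orders h) ((mem_of_mem_orders h).2 hi)
    rw [length_of_mem_orders h] at this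
    rw [← this]
    push_cast
    ring
  rw [Finset.expect_add_distrib, ← hrev] at hsum
  linarith

end Orders

/-! ### Well-formed states and the cost of queueing agents -/

/-- The states that occur in the game: nobody is in the queue twice, and nobody is both in the
queue and outside. -/
structure State.WellFormed {n : ℕ} (s : State n) : Prop where
  nodup : s.queue.Nodup
  disjoint : ∀ i ∈ s.queue, i ∉ s.outside

section Steps

variable {n : ℕ} {s : State n} {E : Finset (Fin n)} {l : List (Fin n)} {i : Fin n}

lemma State.WellFormed.card_add_length_le (hs : s.WellFormed) :
    s.outside.card + s.queue.length ≤ n := by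
  have hd : Disjoint s.outside s.queue.toFinset := by
    rw [Finset.disjoint_right]
    intro i hi
    exact hs.disjoint i (List.mem_toFinset.1 hi)
  have h := Finset.card_le_univ (s.outside ∪ s.queue.toFinset)
  rwa [Finset.card_union_of_disjoint hd, List.toFinset_card_of_nodup hs.nodup,
    Fintype.card_fin] at h

lemma State.WellFormed.nodup_append (hs : s.WellFormed) (hE : E ⊆ s.outside)
    (hl : l ∈ orders E) : (s.queue ++ l).Nodup := by
  rw [List.nodup_append']
  refine ⟨hs.nodup, nodup_of_mem_orders hl, fun j hj hjl => ?_⟩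
  exact hs.disjoint j hj (hE ((mem_of_mem_orders hl).1 hjl))

lemma State.WellFormed.next (hs : s.WellFormed) (hE : E ⊆ s.outside) (hl : l ∈ orders E) :
    (s.next E l).WellFormed where
  nodup := (hs.nodup_append hE hl).tail
  disjoint := by
    intro i hi
    have hi' := List.mem_of_mem_tail hi
    simp only [State.next, Finset.mem_sdiff, not_and_not_right]
    intro ho
    rcases List.mem_append.1 hi' with h | h
    · exact absurd ho (hs.disjoint i h)
    · exact (mem_of_mem_orders hl).1 h

lemma State.WellFormed.initial (n : ℕ) : (State.initial n).WellFormed :=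
  ⟨List.nodup_nil, fun i hi => by simp [State.initial] at hi⟩

lemma card_outside_next (hE : E ⊆ s.outside) (l : List (Fin n)) :
    (s.next E l).outside.card = s.outside.card - E.card :=
  Finset.card_sdiff_of_subset hE

lemma length_queue_next (hl : l ∈ orders E) :
    (s.next E l).queue.length = s.queue.length + E.card - 1 := by
  simp [State.next, length_of_mem_orders hl]

lemma sum_entrySetProb (P : Profile n) (s : State n) :
    ∑ E ∈ s.outside.powerset, entrySetProb P s E = 1 := by
  have h := Finset.prod_add (fun i => enterProb P s i) (fun i => 1 - enterProb P s i) s.outside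
  simpa [entrySetProb] using h.symm

/-- The number of agents in front of `i`; it is `0` for an agent who is not in the list. -/
def depth (q : List (Fin n)) (i : Fin n) : ℕ := if i ∈ q then q.idxOf i else 0

lemma depth_tail {q : List (Fin n)} (hq : q.Nodup) (i : Fin n) :
    depth q.tail i = depth q i - 1 := by
  cases q with
  | nil => simp [depth]
  | cons a q =>
    rw [List.nodup_cons] at hq
    by_cases h : a = i
    · subst h
      simp [depth, hq.1]
    · have h' : i ≠ a := fun e => h e.symm
      by_cases hi : i ∈ q <;> simp [depth, hi, h', List.idxOf_cons_ne _ h]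

lemma depth_pos_iff_mem_tail {q : List (Fin n)} (hq : q.Nodup) (i : Fin n) :
    0 < depth q i ↔ i ∈ q.tail := by
  cases q with
  | nil => simp [depth]
  | cons a q =>
    rw [List.nodup_cons] at hq
    by_cases h : a = i
    · subst h
      simp [depth, hq.1]
    · have h' : i ≠ a := fun e => h e.symm
      by_cases hi : i ∈ q <;> simp [depth, hi, h', List.idxOf_cons_ne _ h]

/-- An agent in the queue, with `d` agents in front of him, pays `w` in each of the next `d`
steps. -/
lemma stepCost_add_min_depth (w : ℝ) (T : ℕ) (hq : (s.queue ++ l).Nodup)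
    (hi : i ∉ s.outside \ E) :
    s.stepCost w E l i + w * (min (depth (s.next E l).queue i) T : ℕ)
      = w * (min (depth (s.queue ++ l) i) (T + 1) : ℕ) := by
  have hnext : depth (s.next E l).queue i = depth (s.queue ++ l) i - 1 := depth_tail hq i
  rw [hnext, State.stepCost, if_neg hi]
  by_cases h : i ∈ (s.queue ++ l).tail
  · rw [if_pos h]
    have hp := (depth_pos_iff_mem_tail hq i).2 h
    have : min (depth (s.queue ++ l) i) (T + 1) = min (depth (s.queue ++ l) i - 1) T + 1 := by
      omega
    rw [this]
    push_cast
    ring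
  · rw [if_neg h]
    have hp : depth (s.queue ++ l) i = 0 := by
      by_contra h0
      exact h ((depth_pos_iff_mem_tail hq i).1 (Nat.pos_of_ne_zero h0))
    simp [hp]

lemma costUpTo_of_notMem_outside (P : Profile n) (w : ℝ) (T : ℕ) :
    ∀ {s : State n}, s.WellFormed → ∀ {i : Fin n}, i ∉ s.outside →
      costUpTo P w T s i = w * (min (depth s.queue i) T : ℕ) := by
  induction T with
  | zero =>
    intro s _ i _
    simp [costUpTo]
  | succ T ih =>
    intro s hs i hi
    have key : ∀ E ∈ s.outside.powerset, (entrySetProb P s E *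
        Finset.expect (orders E) fun l => s.stepCost w E l i + costUpTo P w T (s.next E l) i)
        = entrySetProb P s E * (w * (min (depth s.queue i) (T + 1) : ℕ)) := by
      intro E hE
      rw [Finset.mem_powerset] at hE
      congr 1
      rw [← Finset.expect_const (orders_nonempty E) (w * (min (depth s.queue i) (T + 1) : ℕ) : ℝ)]
      refine Finset.expect_congr rfl fun l hl => ?_
      have hi' : i ∉ s.outside \ E := fun h => hi (Finset.mem_sdiff.1 h).1
      rw [ih (hs.next hE hl) (i := i) hi',
        stepCost_add_min_depth w T (hs.nodup_append hE hl) hi']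
      have hil : i ∉ l := fun h => hi (hE ((mem_of_mem_orders hl).1 h))
      have : depth (s.queue ++ l) i = depth s.queue i := by
        by_cases hq : i ∈ s.queue
        · simp [depth, hq, List.idxOf_append_of_mem hq]
        · simp [depth, hq, hil]
      rw [this]
    rw [costUpTo, Finset.sum_congr rfl key, ← Finset.sum_mul, sum_entrySetProb, one_mul]

end Steps

/-! ### Reduction to a Markov chain -/

/-- The profile in which agent `i` plays `S'` and everybody else plays `S`. -/
abbrev deviation (n : ℕ) (S S' : Strategy) (i : Fin n) : Profile n :=
  Function.update (symmetric n S) i S'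

/-- One step of the recursion for the cost of an agent outside the queue who enters with
probability `p` while each of the `M` others outside enters with probability `q`, when `k` agents
are in the queue. The cost of entering is charged at once: on average `k + M * q / 2` agents are in
front of him. If he stays outside and `e` others enter, his cost from the next step on is `f e`. -/
def bellman (w p q : ℝ) (M k : ℕ) (f : ℕ → ℝ) : ℝ :=
  p * (w * (k + M * q / 2)) +
    (1 - p) * (1 + ∑ e ∈ Finset.range (M + 1), binomialWeight M q e * f e)

/-- The cost, with entering agents charged at once and other agents charged for `T` steps, of an
agent outside the queue who plays `S'`, when `M` others who play `S` are outside and `k` agents are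
in the queue. -/
def chainCost (S S' : Strategy) (w : ℝ) : ℕ → ℕ → ℕ → ℝ
  | 0, _, _ => 0
  | T + 1, M, k => bellman w (S' (M + 1) k) (S (M + 1) k) M k
      fun e => chainCost S S' w T (M - e) (k + e - 1)

section Reduction

variable {n : ℕ} {s : State n} {i : Fin n} (S S' : Strategy) (w : ℝ) (T : ℕ)

lemma prod_enterProb_deviation {E : Finset (Fin n)} (hiE : i ∉ E) :
    ∏ j ∈ E, enterProb (deviation n S S' i) s j
      = (S s.outside.card s.queue.length : ℝ) ^ E.card := by
  rw [← Finset.prod_const]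
  refine Finset.prod_congr rfl fun j hj => ?_
  have : j ≠ i := fun h => hiE (h ▸ hj)
  simp [enterProb, deviation, symmetric, Function.update_of_ne this]

lemma prod_one_sub_enterProb_deviation {E : Finset (Fin n)} (hE : E ⊆ s.outside.erase i) :
    ∏ j ∈ s.outside.erase i \ E, (1 - enterProb (deviation n S S' i) s j)
      = (1 - S s.outside.card s.queue.length : ℝ) ^ ((s.outside.erase i).card - E.card) := by
  rw [← Finset.card_sdiff_of_subset hE, ← Finset.prod_const]
  refine Finset.prod_congr rfl fun j hj => ?_
  have : j ≠ i := fun h => by simp [h] at hj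
  simp [enterProb, deviation, symmetric, Function.update_of_ne this]

lemma entrySetProb_deviation_of_notMem {E : Finset (Fin n)} (hi : i ∈ s.outside)
    (hE : E ⊆ s.outside.erase i) :
    entrySetProb (deviation n S S' i) s E
      = (1 - S' s.outside.card s.queue.length) * ((S s.outside.card s.queue.length : ℝ) ^ E.card *
        (1 - S s.outside.card s.queue.length) ^ ((s.outside.erase i).card - E.card)) := by
  have hiE : i ∉ E := fun h => Finset.notMem_erase i _ (hE h)
  have hsplit : s.outside \ E = insert i (s.outside.erase i \ E) := by
    ext j
    by_cases h : j = i
    · subst h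
      simp [hi, hiE]
    · simp [h]
  rw [entrySetProb, prod_enterProb_deviation S S' hiE, hsplit, Finset.prod_insert (by simp),
    prod_one_sub_enterProb_deviation S S' hE]
  simp only [enterProb, deviation, Function.update_self]
  ring

lemma entrySetProb_deviation_insert {E : Finset (Fin n)} (hE : E ⊆ s.outside.erase i) :
    entrySetProb (deviation n S S' i) s (insert i E)
      = S' s.outside.card s.queue.length * ((S s.outside.card s.queue.length : ℝ) ^ E.card *
        (1 - S s.outside.card s.queue.length) ^ ((s.outside.erase i).card - E.card)) := by
  have hiE : i ∉ E := fun h => Finset.notMem_erase i _ (hE h)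
  have hsplit : s.outside \ insert i E = s.outside.erase i \ E := by
    ext j
    by_cases h : j = i
    · subst h
      simp
    · simp [h]
  rw [entrySetProb, Finset.prod_insert hiE, prod_enterProb_deviation S S' hiE, hsplit,
    prod_one_sub_enterProb_deviation S S' hE]
  simp only [enterProb, deviation, Function.update_self]
  ring

lemma costUpTo_deviation_succ (hs : s.WellFormed) (hi : i ∈ s.outside) :
    costUpTo (deviation n S S' i) w (T + 1) s i
      = ∑ E ∈ (s.outside.erase i).powerset, ((S s.outside.card s.queue.length : ℝ) ^ E.card *
          (1 - S s.outside.card s.queue.length) ^ ((s.outside.erase i).card - E.card)) *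
        (S' s.outside.card s.queue.length * Finset.expect (orders (insert i E))
            (fun l => w * (min (s.queue.length + l.idxOf i) (T + 1) : ℕ)) +
          (1 - S' s.outside.card s.queue.length) * (1 + Finset.expect (orders E)
            (fun l => costUpTo (deviation n S S' i) w T (s.next E l) i))) := by
  have hpow : s.outside.powerset = (insert i (s.outside.erase i)).powerset := by
    rw [Finset.insert_erase hi]
  rw [costUpTo, hpow, Finset.sum_powerset_insert (Finset.notMem_erase i _),
    ← Finset.sum_add_distrib]
  refine Finset.sum_congr rfl fun E hE => ?_
  rw [Finset.mem_powerset] at hE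
  have hiE : i ∉ E := fun h => Finset.notMem_erase i _ (hE h)
  have hEo : E ⊆ s.outside := hE.trans (Finset.erase_subset _ _)
  have hins : insert i E ⊆ s.outside := Finset.insert_subset hi hEo
  have hstay : Finset.expect (orders E) (fun l => s.stepCost w E l i +
      costUpTo (deviation n S S' i) w T (s.next E l) i)
      = 1 + Finset.expect (orders E)
        (fun l => costUpTo (deviation n S S' i) w T (s.next E l) i) := by
    rw [Finset.expect_add_distrib]
    congr 1
    rw [← Finset.expect_const (orders_nonempty E) (1 : ℝ)]
    refine Finset.expect_congr rfl fun l _ => ?_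
    rw [State.stepCost, if_pos (Finset.mem_sdiff.2 ⟨hi, hiE⟩)]
  have henter : Finset.expect (orders (insert i E)) (fun l => s.stepCost w (insert i E) l i +
      costUpTo (deviation n S S' i) w T (s.next (insert i E) l) i)
      = Finset.expect (orders (insert i E))
        (fun l => w * (min (s.queue.length + l.idxOf i) (T + 1) : ℕ)) := by
    refine Finset.expect_congr rfl fun l hl => ?_
    have hni : i ∉ s.outside \ insert i E := by simp
    rw [costUpTo_of_notMem_outside _ w T (hs.next hins hl) (i := i) hni,
      stepCost_add_min_depth w T (hs.nodup_append hins hl) hni]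
    have hq : i ∉ s.queue := fun h => hs.disjoint i h hi
    have hil : i ∈ l := (mem_of_mem_orders hl).2 (Finset.mem_insert_self _ _)
    simp [depth, hil, List.idxOf_append_of_notMem hq]
  rw [hstay, henter, entrySetProb_deviation_of_notMem S S' hi hE,
    entrySetProb_deviation_insert S S' hE]
  ring

lemma bellman_eq_sum_powerset {R : Finset (Fin n)} (p q : ℝ) (k : ℕ) (f : ℕ → ℝ) :
    bellman w p q R.card k f = ∑ E ∈ R.powerset, (q ^ E.card * (1 - q) ^ (R.card - E.card)) *
      (p * (w * (k + (E.card : ℝ) / 2)) + (1 - p) * (1 + f E.card)) := by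
  rw [Finset.sum_powerset_apply_card
    (fun e => (q ^ e * (1 - q) ^ (R.card - e)) *
      (p * (w * (k + (e : ℝ) / 2)) + (1 - p) * (1 + f e)))]
  have hterm : ∀ e ∈ Finset.range (R.card + 1),
      R.card.choose e • ((q ^ e * (1 - q) ^ (R.card - e)) *
        (p * (w * (k + (e : ℝ) / 2)) + (1 - p) * (1 + f e)))
      = (p * w * k + (1 - p)) * binomialWeight R.card q e
        + (p * w / 2) * (binomialWeight R.card q e * e)
        + (1 - p) * (binomialWeight R.card q e * f e) := by
    intro e _
    rw [nsmul_eq_mul, binomialWeight]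
    ring
  rw [Finset.sum_congr rfl hterm, Finset.sum_add_distrib, Finset.sum_add_distrib,
    ← Finset.mul_sum, ← Finset.mul_sum, ← Finset.mul_sum, sum_binomialWeight,
    sum_binomialWeight_mul, bellman]
  ring

variable {w}

/-- The expected payment of an entering agent, once he is charged for the whole queue. -/
lemma expect_entering_cost {E : Finset (Fin n)} (hE : i ∉ E) (k : ℕ) :
    Finset.expect (orders (insert i E)) (fun l => w * ((k : ℝ) + l.idxOf i))
      = w * (k + (E.card : ℝ) / 2) := by
  rw [← Finset.mul_expect, Finset.expect_add_distrib, Finset.expect_const (orders_nonempty _),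
    expect_idxOf (Finset.mem_insert_self i E), Finset.card_insert_of_notMem hE]
  push_cast
  ring

lemma costUpTo_le_chainCost (hw : 0 ≤ w) : ∀ {s : State n}, s.WellFormed → i ∈ s.outside →
    costUpTo (deviation n S S' i) w T s i
      ≤ chainCost S S' w T (s.outside.erase i).card s.queue.length := by
  induction T with
  | zero =>
    intro s _ _
    simp [costUpTo, chainCost]
  | succ T ih =>
    intro s hs hi
    have hcard : (s.outside.erase i).card + 1 = s.outside.card := Finset.card_erase_add_one hi
    rw [costUpTo_deviation_succ S S' w T hs hi, chainCost, bellman_eq_sum_powerset, hcard]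
    refine Finset.sum_le_sum fun E hE => ?_
    rw [Finset.mem_powerset] at hE
    have hiE : i ∉ E := fun h => Finset.notMem_erase i _ (hE h)
    have hEo : E ⊆ s.outside := hE.trans (Finset.erase_subset _ _)
    have hq := (S s.outside.card s.queue.length).2
    have hp := (S' s.outside.card s.queue.length).2
    refine mul_le_mul_of_nonneg_left (add_le_add (mul_le_mul_of_nonneg_left ?_ hp.1)
      (mul_le_mul_of_nonneg_left (add_le_add_right ?_ 1) (by linarith [hp.2])))
      (mul_nonneg (pow_nonneg hq.1 _) (pow_nonneg (by linarith [hq.2]) _))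
    · rw [← expect_entering_cost hiE]
      refine Finset.expect_le_expect fun l _ => mul_le_mul_of_nonneg_left ?_ hw
      exact_mod_cast min_le_left _ _
    · refine Finset.expect_le (orders_nonempty E) fun l hl => ?_
      have h := ih (hs.next hEo hl) (Finset.mem_sdiff.2 ⟨hi, hiE⟩)
      rw [length_queue_next hl] at h
      have hc : ((s.next E l).outside.erase i).card = (s.outside.erase i).card - E.card := by
        have hmem : i ∈ (s.next E l).outside := Finset.mem_sdiff.2 ⟨hi, hiE⟩
        rw [Finset.card_erase_of_mem hmem, card_outside_next hEo]
        omega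
      rwa [hc] at h

lemma entrySetProb_nonneg (P : Profile n) (s : State n) (E : Finset (Fin n)) :
    0 ≤ entrySetProb P s E :=
  mul_nonneg (Finset.prod_nonneg fun j _ => (P j s.outside.card s.queue.length).2.1)
    (Finset.prod_nonneg fun j _ => sub_nonneg.2 (P j s.outside.card s.queue.length).2.2)

lemma costUpTo_nonneg (P : Profile n) (hw : 0 ≤ w) (T : ℕ) :
    ∀ (s : State n) (i : Fin n), 0 ≤ costUpTo P w T s i := by
  induction T with
  | zero => exact fun _ _ => le_rfl
  | succ T ih =>
    intro s i
    refine Finset.sum_nonneg fun E _ => mul_nonneg (entrySetProb_nonneg P s E) ?_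
    refine Finset.expect_nonneg fun l _ => add_nonneg ?_ (ih _ _)
    unfold State.stepCost
    split_ifs <;> positivity

/-- No agent has more than `n` agents in front of him, so charging an entering agent at once makes
no difference after `n` more steps. -/
lemma chainCost_le_costUpTo (hw : 0 ≤ w) : ∀ {s : State n}, s.WellFormed → i ∈ s.outside →
    chainCost S S' w T (s.outside.erase i).card s.queue.length
      ≤ costUpTo (deviation n S S' i) w (T + n) s i := by
  induction T with
  | zero =>
    intro s _ _
    exact costUpTo_nonneg _ hw _ _ _
  | succ T ih =>
    intro s hs hi
    have hcard : (s.outside.erase i).card + 1 = s.outside.card := Finset.card_erase_add_one hi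
    have hT : T + 1 + n = (T + n) + 1 := by omega
    rw [hT, costUpTo_deviation_succ S S' w (T + n) hs hi, chainCost, bellman_eq_sum_powerset,
      hcard]
    refine Finset.sum_le_sum fun E hE => ?_
    rw [Finset.mem_powerset] at hE
    have hiE : i ∉ E := fun h => Finset.notMem_erase i _ (hE h)
    have hEo : E ⊆ s.outside := hE.trans (Finset.erase_subset _ _)
    have hq := (S s.outside.card s.queue.length).2
    have hp := (S' s.outside.card s.queue.length).2
    refine mul_le_mul_of_nonneg_left (add_le_add (mul_le_mul_of_nonneg_left ?_ hp.1)
      (mul_le_mul_of_nonneg_left (add_le_add_right ?_ 1) (by linarith [hp.2])))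
      (mul_nonneg (pow_nonneg hq.1 _) (pow_nonneg (by linarith [hq.2]) _))
    · rw [← expect_entering_cost hiE]
      refine Finset.expect_le_expect fun l hl => mul_le_mul_of_nonneg_left ?_ hw
      have hil : i ∈ l := (mem_of_mem_orders hl).2 (Finset.mem_insert_self _ _)
      have h1 := List.idxOf_lt_length_iff.2 hil
      rw [length_of_mem_orders hl] at h1
      have h2 := Finset.card_le_card (Finset.insert_subset hi hEo)
      have h3 := hs.card_add_length_le
      rw [min_eq_left (by omega)]
      push_cast
      exact le_rfl
    · refine Finset.le_expect (orders_nonempty E) fun l hl => ?_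
      have h := ih (hs.next hEo hl) (Finset.mem_sdiff.2 ⟨hi, hiE⟩)
      rw [length_queue_next hl] at h
      have hc : ((s.next E l).outside.erase i).card = (s.outside.erase i).card - E.card := by
        have hmem : i ∈ (s.next E l).outside := Finset.mem_sdiff.2 ⟨hi, hiE⟩
        rw [Finset.card_erase_of_mem hmem, card_outside_next hEo]
        omega
      rwa [hc] at h

/-- The expected total cost, as an element of `[0, ∞]`, of an agent outside the queue who plays
`S'`, when `M` others who play `S` are outside and `k` agents are in the queue. -/
def chainValue (S S' : Strategy) (w : ℝ) (M k : ℕ) : ℝ≥0∞ :=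
  ⨆ T : ℕ, ENNReal.ofReal (chainCost S S' w T M k)

lemma cost_deviation (hw : 0 ≤ w) (i : Fin n) :
    cost (deviation n S S' i) w i = chainValue S S' w (n - 1) 0 := by
  have hs := State.WellFormed.initial n
  have hi : i ∈ (State.initial n).outside := Finset.mem_univ i
  have hcard : ((State.initial n).outside.erase i).card = n - 1 := by
    rw [Finset.card_erase_of_mem hi]
    simp [State.initial]
  have hlen : (State.initial n).queue.length = 0 := rfl
  refine le_antisymm (iSup_le fun T => ?_) (iSup_le fun T => ?_)
  · refine le_trans (ENNReal.ofReal_le_ofReal ?_)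
      (le_iSup (fun T => ENNReal.ofReal (chainCost S S' w T (n - 1) 0)) T)
    have h := costUpTo_le_chainCost S S' T hw hs hi
    rwa [hcard, hlen] at h
  · refine le_trans (ENNReal.ofReal_le_ofReal ?_) (le_iSup (fun T => ENNReal.ofReal
      (costUpTo (deviation n S S' i) w T (State.initial n) i)) (T + n))
    have h := chainCost_le_costUpTo S S' T hw hs hi
    rwa [hcard, hlen] at h

lemma cost_symmetric (hw : 0 ≤ w) (i : Fin n) :
    cost (symmetric n S) w i = chainValue S S w (n - 1) 0 := by
  rw [← cost_deviation S S hw i, deviation]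
  congr 1
  exact (Function.update_eq_self i (symmetric n S)).symm

lemma socialCost_symmetric (n : ℕ) (hw : 0 ≤ w) :
    socialCost (symmetric n S) w = n * chainValue S S w (n - 1) 0 := by
  simp [socialCost, cost_symmetric S hw]

lemma isSymmetricEquilibrium_iff (hw : 0 ≤ w) (hn : 0 < n) :
    IsSymmetricEquilibrium n w S ↔
      ∀ S' : Strategy, chainValue S S w (n - 1) 0 ≤ chainValue S S' w (n - 1) 0 := by
  constructor
  · intro h S'
    have := h ⟨0, hn⟩ S'
    rwa [cost_symmetric S hw, cost_deviation S S' hw] at this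
  · intro h i S'
    rw [cost_symmetric S hw, cost_deviation S S' hw]
    exact h S'

end Reduction

/-! ### The cost of staying outside and the chain value -/

/-- The expected cost of an agent who stays outside for this step, when `M` others enter with
probability `q` each and his cost from the next step on is `f e` if `e` of them enter. -/
def stayCost (q : ℝ) (M : ℕ) (f : ℕ → ℝ) : ℝ :=
  1 + ∑ e ∈ Finset.range (M + 1), binomialWeight M q e * f e

lemma bellman_eq (w p q : ℝ) (M k : ℕ) (f : ℕ → ℝ) :
    bellman w p q M k f = p * (w * (k + M * q / 2)) + (1 - p) * stayCost q M f := rfl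

lemma stayCost_mono {q : ℝ} (h0 : 0 ≤ q) (h1 : q ≤ 1) {M : ℕ} {f g : ℕ → ℝ}
    (h : ∀ e ≤ M, f e ≤ g e) : stayCost q M f ≤ stayCost q M g := by
  refine add_le_add_right (Finset.sum_le_sum fun e he => ?_) 1
  exact mul_le_mul_of_nonneg_left (h e (Nat.lt_succ_iff.1 (Finset.mem_range.1 he)))
    (binomialWeight_nonneg h0 h1 e)

lemma stayCost_const (q : ℝ) (M : ℕ) (c : ℝ) : stayCost q M (fun _ => c) = 1 + c := by
  rw [stayCost, ← Finset.sum_mul, sum_binomialWeight, one_mul]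

lemma stayCost_sub_const (q : ℝ) (M : ℕ) (f : ℕ → ℝ) (c : ℝ) :
    stayCost q M (fun e => f e - c) = stayCost q M f - c := by
  have := sum_binomialWeight M q
  simp only [stayCost, mul_sub, Finset.sum_sub_distrib, ← Finset.sum_mul, this]
  ring

lemma stayCost_update {q : ℝ} {M : ℕ} (f : ℕ → ℝ) {a : ℕ} (ha : a ≤ M) (x : ℝ) :
    stayCost q M (Function.update f a x)
      = stayCost q M f + binomialWeight M q a * (x - f a) := by
  have hmem : a ∈ Finset.range (M + 1) := Finset.mem_range.2 (Nat.lt_succ_iff.2 ha)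
  have h1 := Finset.add_sum_erase (Finset.range (M + 1))
    (fun e => binomialWeight M q e * f e) hmem
  have h2 := Finset.add_sum_erase (Finset.range (M + 1))
    (fun e => binomialWeight M q e * Function.update f a x e) hmem
  have h3 : ∑ e ∈ (Finset.range (M + 1)).erase a, binomialWeight M q e * Function.update f a x e
      = ∑ e ∈ (Finset.range (M + 1)).erase a, binomialWeight M q e * f e := by
    refine Finset.sum_congr rfl fun e he => ?_
    rw [Function.update_of_ne (Finset.ne_of_mem_erase he)]
  simp only [Function.update_self] at h2
  rw [stayCost, stayCost, ← h1, ← h2, h3]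
  ring

lemma one_le_stayCost {q : ℝ} (h0 : 0 ≤ q) (h1 : q ≤ 1) {M : ℕ} {f : ℕ → ℝ}
    (h : ∀ e ≤ M, 0 ≤ f e) : 1 ≤ stayCost q M f := by
  have := stayCost_mono h0 h1 (f := fun _ => 0) h
  rwa [stayCost_const, add_zero] at this

section Chain

variable {S S' : Strategy} {w : ℝ}

lemma bellman_mono {p q : ℝ} (hp : p ≤ 1) (h0 : 0 ≤ q) (h1 : q ≤ 1)
    {M k : ℕ} {f g : ℕ → ℝ} (h : ∀ e ≤ M, f e ≤ g e) :
    bellman w p q M k f ≤ bellman w p q M k g := by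
  rw [bellman_eq, bellman_eq]
  have := mul_le_mul_of_nonneg_left (stayCost_mono h0 h1 h) (sub_nonneg.2 hp)
  linarith

lemma bellman_nonneg (hw : 0 ≤ w) {p q : ℝ} (hp0 : 0 ≤ p) (hp : p ≤ 1) (h0 : 0 ≤ q) (h1 : q ≤ 1)
    {M k : ℕ} {f : ℕ → ℝ} (h : ∀ e ≤ M, 0 ≤ f e) : 0 ≤ bellman w p q M k f := by
  rw [bellman_eq]
  have := one_le_stayCost h0 h1 h
  have hp' : 0 ≤ 1 - p := by linarith
  positivity

lemma chainCost_nonneg (hw : 0 ≤ w) (T : ℕ) : ∀ M k : ℕ, 0 ≤ chainCost S S' w T M k := by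
  induction T with
  | zero => exact fun _ _ => le_rfl
  | succ T ih =>
    intro M k
    exact bellman_nonneg hw (S' _ _).2.1 (S' _ _).2.2 (S _ _).2.1 (S _ _).2.2 fun e _ => ih _ _

lemma chainCost_le_succ (hw : 0 ≤ w) (T : ℕ) :
    ∀ M k : ℕ, chainCost S S' w T M k ≤ chainCost S S' w (T + 1) M k := by
  induction T with
  | zero => exact fun M k => chainCost_nonneg hw 1 M k
  | succ T ih =>
    intro M k
    exact bellman_mono (S' _ _).2.2 (S _ _).2.1 (S _ _).2.2 fun e _ => ih _ _

lemma monotone_chainCost (hw : 0 ≤ w) (M k : ℕ) :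
    Monotone fun T => chainCost S S' w T M k :=
  monotone_nat_of_le_succ fun T => chainCost_le_succ hw T M k

/-- A nonnegative supersolution of the recursion bounds the cost from above. It suffices to have it
for the numbers of agents that occur. -/
lemma chainValue_le_of_bellman_le {Φ : ℕ → ℕ → ℝ} (h0 : ∀ M k, 0 ≤ Φ M k) {M₀ : ℕ}
    (h : ∀ M ≤ M₀, ∀ k,
      bellman w (S' (M + 1) k) (S (M + 1) k) M k (fun e => Φ (M - e) (k + e - 1)) ≤ Φ M k)
    (k : ℕ) : chainValue S S' w M₀ k ≤ ENNReal.ofReal (Φ M₀ k) := by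
  have key : ∀ T, ∀ M ≤ M₀, ∀ k, chainCost S S' w T M k ≤ Φ M k := by
    intro T
    induction T with
    | zero => exact fun M _ k => h0 M k
    | succ T ih =>
      intro M hM k
      refine le_trans ?_ (h M hM k)
      exact bellman_mono (S' _ _).2.2 (S _ _).2.1 (S _ _).2.2
        fun e _ => ih _ ((Nat.sub_le _ _).trans hM) _
  exact iSup_le fun T => ENNReal.ofReal_le_ofReal (key T M₀ le_rfl k)

/-- One step of the recursion turns lower bounds for the value into a lower bound; this is the only
form in which the fixed-point equation for the value is needed, and it allows infinite values. -/
lemma ofReal_bellman_le_chainValue (hw : 0 ≤ w) {M k : ℕ} {f : ℕ → ℝ}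
    (h : ∀ e ≤ M, ENNReal.ofReal (f e) ≤ chainValue S S' w (M - e) (k + e - 1)) :
    ENNReal.ofReal (bellman w (S' (M + 1) k) (S (M + 1) k) M k f) ≤ chainValue S S' w M k := by
  refine ENNReal.le_of_forall_pos_le_add fun ε hε _ => ?_
  have hε' : (0 : ℝ) < ε := hε
  have hT : ∀ e, ∃ T, e ≤ M → f e - ε ≤ chainCost S S' w T (M - e) (k + e - 1) := by
    intro e
    by_cases he : e ≤ M
    · by_cases hf : f e ≤ 0
      · exact ⟨0, fun _ => by simp only [chainCost]; linarith⟩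
      · have hlt : ENNReal.ofReal (f e - ε) < chainValue S S' w (M - e) (k + e - 1) :=
          lt_of_lt_of_le ((ENNReal.ofReal_lt_ofReal_iff (not_le.1 hf)).2 (by linarith)) (h e he)
        obtain ⟨T, hT⟩ := lt_iSup_iff.1 hlt
        refine ⟨T, fun _ => ?_⟩
        exact (ENNReal.ofReal_le_ofReal_iff (chainCost_nonneg hw _ _ _)).1 hT.le
    · exact ⟨0, fun h' => absurd h' he⟩
  choose t ht using hT
  set T := (Finset.range (M + 1)).sup t with hTdef
  have hle : bellman w (S' (M + 1) k) (S (M + 1) k) M k f - ε ≤ chainCost S S' w (T + 1) M k := by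
    have h1 : bellman w (S' (M + 1) k) (S (M + 1) k) M k (fun e => f e - ε)
        ≤ chainCost S S' w (T + 1) M k := by
      refine bellman_mono (S' _ _).2.2 (S _ _).2.1 (S _ _).2.2 fun e he => ?_
      refine (ht e he).trans (monotone_chainCost hw _ _ ?_)
      exact Finset.le_sup (f := t) (Finset.mem_range.2 (Nat.lt_succ_iff.2 he))
    rw [bellman_eq, stayCost_sub_const] at h1
    rw [bellman_eq]
    nlinarith [mul_nonneg (S' (M + 1) k).2.1 hε'.le]
  calc ENNReal.ofReal (bellman w (S' (M + 1) k) (S (M + 1) k) M k f)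
      = ENNReal.ofReal ((bellman w (S' (M + 1) k) (S (M + 1) k) M k f - ε) + ε) := by
        rw [sub_add_cancel]
    _ ≤ ENNReal.ofReal (bellman w (S' (M + 1) k) (S (M + 1) k) M k f - ε) + ENNReal.ofReal ε :=
        ENNReal.ofReal_add_le
    _ ≤ chainValue S S' w M k + ε := by
        rw [ENNReal.ofReal_coe_nnreal]
        exact add_le_add_left ((ENNReal.ofReal_le_ofReal hle).trans
          (le_iSup (fun T => ENNReal.ofReal (chainCost S S' w T M k)) (T + 1))) _

end Chain

/-! ### The optimal value of a deviator -/

/-- Auxiliary form of `optValue`, by recursion on the number `N = M + k`, which decreases by one in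
each step in which the state changes. In the state with empty queue, where the state is kept as
long as nobody enters, the equation for the cost of staying outside is solved for that cost. -/
def optValueAux (S : Strategy) (w : ℝ) : ℕ → ℕ → ℝ
  | 0, _ => 0
  | N + 1, M => min (w * ((N + 1 - M : ℕ) + M * (S (M + 1) (N + 1 - M) : ℝ) / 2))
      (if N + 1 - M = 0 then
        (1 + ∑ e ∈ Finset.range M, binomialWeight M (S (M + 1) 0) (e + 1) *
          optValueAux S w N (M - (e + 1))) / (1 - (1 - (S (M + 1) 0 : ℝ)) ^ M)
      else stayCost (S (M + 1) (N + 1 - M)) M fun e => optValueAux S w N (M - e))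

/-- The least cost that an agent outside the queue can achieve against `M` others outside who play
`S`, when `k` agents are in the queue. -/
def optValue (S : Strategy) (w : ℝ) (M k : ℕ) : ℝ := optValueAux S w (M + k) M

section OptValue

variable {S : Strategy} {w : ℝ}

@[simp] lemma optValue_zero_zero : optValue S w 0 0 = 0 := rfl

lemma optValue_queue_succ (M k : ℕ) :
    optValue S w M (k + 1) = min (w * ((k + 1 : ℕ) + M * (S (M + 1) (k + 1) : ℝ) / 2))
      (stayCost (S (M + 1) (k + 1)) M fun e => optValue S w (M - e) (k + 1 + e - 1)) := by
  have hk : M + k + 1 - M = k + 1 := by omega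
  have h : optValue S w M (k + 1) = optValueAux S w (M + k + 1) M := rfl
  rw [h, optValueAux, hk, if_neg (Nat.succ_ne_zero k)]
  congr 1
  unfold stayCost
  congr 1
  refine Finset.sum_congr rfl fun e he => ?_
  rw [Finset.mem_range] at he
  dsimp only [optValue]
  congr 2
  omega

lemma optValue_succ_zero (M : ℕ) :
    optValue S w (M + 1) 0 = min (w * ((M + 1 : ℕ) * (S (M + 2) 0 : ℝ) / 2))
      ((1 + ∑ e ∈ Finset.range (M + 1), binomialWeight (M + 1) (S (M + 2) 0) (e + 1) *
          optValue S w (M - e) e) / (1 - (1 - (S (M + 2) 0 : ℝ)) ^ (M + 1))) := by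
  have hk : M + 1 - (M + 1) = 0 := by omega
  have h : optValue S w (M + 1) 0 = optValueAux S w (M + 1) (M + 1) := rfl
  rw [h, optValueAux, hk, if_pos rfl, Nat.cast_zero, zero_add]
  congr 3
  refine Finset.sum_congr rfl fun e he => ?_
  rw [Finset.mem_range] at he
  rw [optValue, Nat.add_sub_add_right]
  congr 2
  omega

lemma stayCost_empty_queue (q : ℝ) (M : ℕ) (f : ℕ → ℕ → ℝ) :
    stayCost q (M + 1) (fun e => f (M + 1 - e) (0 + e - 1))
      = (1 - q) ^ (M + 1) * f (M + 1) 0 +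
        (1 + ∑ e ∈ Finset.range (M + 1), binomialWeight (M + 1) q (e + 1) * f (M - e) e) := by
  rw [stayCost, Finset.sum_range_succ']
  simp only [Nat.add_sub_add_right, binomialWeight_zero_right]
  simp
  ring

lemma optValue_nonneg (hw : 0 ≤ w) (M k : ℕ) : 0 ≤ optValue S w M k := by
  have aux : ∀ N M, 0 ≤ optValueAux S w N M := by
    intro N
    induction N with
    | zero => exact fun _ => le_rfl
    | succ N ih =>
      intro M
      have hq (k : ℕ) := (S (M + 1) k).2
      rw [optValueAux]
      refine le_min (mul_nonneg hw ?_) ?_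
      · have := (hq (N + 1 - M)).1
        positivity
      · split_ifs
        · refine div_nonneg (add_nonneg zero_le_one (Finset.sum_nonneg fun e _ => ?_)) ?_
          · exact mul_nonneg (binomialWeight_nonneg (hq 0).1 (hq 0).2 _) (ih _)
          · exact sub_nonneg.2 (pow_le_one₀ (sub_nonneg.2 (hq 0).2) (by linarith [(hq 0).1]))
        · exact zero_le_one.trans (one_le_stayCost (hq _).1 (hq _).2 fun e _ => ih _)
  exact aux _ _

/-- The optimality equation: the optimal value is the smaller one of the cost of entering and the
cost of staying outside. -/
lemma optValue_eq_min (hw : 0 ≤ w) (M k : ℕ) :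
    optValue S w M k = min (w * (k + M * (S (M + 1) k : ℝ) / 2))
      (stayCost (S (M + 1) k) M fun e => optValue S w (M - e) (k + e - 1)) := by
  rcases k with _ | k
  · rcases M with _ | M
    · have := one_le_stayCost (S 1 0).2.1 (S 1 0).2.2
        (M := 0) (f := fun e => optValue S w (0 - e) (0 + e - 1))
        (fun e _ => optValue_nonneg hw _ _)
      rw [min_eq_left]
      · simp
      · simpa using zero_le_one.trans this
    · have hq := (S (M + 2) 0).2
      set q : ℝ := (S (M + 2) 0 : ℝ) with hqdef
      rw [stayCost_empty_queue q M (optValue S w)]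
      have h := optValue_succ_zero (S := S) (w := w) M
      rw [← hqdef] at h
      set c := 1 + ∑ e ∈ Finset.range (M + 1), binomialWeight (M + 1) q (e + 1) *
        optValue S w (M - e) e with hc
      have hcpos : 0 ≤ c := add_nonneg zero_le_one (Finset.sum_nonneg fun e _ =>
        mul_nonneg (binomialWeight_nonneg hq.1 hq.2 _) (optValue_nonneg hw _ _))
      have hV0 := optValue_nonneg (S := S) hw (M + 1) 0
      set V := optValue S w (M + 1) 0 with hV
      have hr1 : (1 - q) ^ (M + 1) ≤ 1 :=
        pow_le_one₀ (sub_nonneg.2 hq.2) (by linarith [hq.1])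
      have hr0 : 0 ≤ (1 - q) ^ (M + 1) := pow_nonneg (sub_nonneg.2 hq.2) _
      set r := (1 - q) ^ (M + 1) with hr
      rw [Nat.cast_zero, zero_add]
      rcases hr1.lt_or_eq with hlt | heq
      · have hX : (1 - r) * (c / (1 - r)) = c := by
          field_simp [(sub_pos.2 hlt).ne']
        rcases le_total (w * ((M + 1 : ℕ) * q / 2)) (c / (1 - r)) with hle | hle
        · rw [min_eq_left hle] at h
          rw [min_eq_left, h]
          have := mul_le_mul_of_nonneg_left (h.le.trans hle) (sub_nonneg.2 hr1)
          rw [← h]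
          linarith
        · rw [min_eq_right hle] at h
          rw [← h] at hX
          have hst : r * V + c = V := by linarith
          rw [hst, min_eq_right]
          rw [h]
          exact hle
      · have hq0 : q = 0 := by
          by_contra hne
          have hpos : 0 < q := lt_of_le_of_ne hq.1 (Ne.symm hne)
          have : (1 - q) ^ (M + 1) < 1 :=
            pow_lt_one₀ (sub_nonneg.2 hq.2) (by linarith) (Nat.succ_ne_zero M)
          linarith
        have hVz : V = 0 := by
          rw [h, heq, hq0]
          simp
        rw [hVz, hq0, min_eq_left]
        · simp
        · simpa using hcpos
  · exact optValue_queue_succ M k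

lemma optValue_le_enter (hw : 0 ≤ w) (M k : ℕ) :
    optValue S w M k ≤ w * (k + M * (S (M + 1) k : ℝ) / 2) := by
  rw [optValue_eq_min hw]
  exact min_le_left _ _

lemma optValue_le_stay (hw : 0 ≤ w) (M k : ℕ) :
    optValue S w M k ≤ stayCost (S (M + 1) k) M fun e => optValue S w (M - e) (k + e - 1) := by
  rw [optValue_eq_min hw]
  exact min_le_right _ _

/-- The optimal value is attained, by entering if and only if this is not worse than staying
outside. -/
lemma exists_chainValue_le_optValue (S : Strategy) (hw : 0 ≤ w) :
    ∃ S' : Strategy, ∀ M k, chainValue S S' w M k ≤ ENNReal.ofReal (optValue S w M k) := by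
  classical
  refine ⟨fun m k => if w * (k + (m - 1 : ℕ) * (S m k : ℝ) / 2)
    ≤ stayCost (S m k) (m - 1) (fun e => optValue S w (m - 1 - e) (k + e - 1)) then 1 else 0,
    fun M k => chainValue_le_of_bellman_le (fun M k => optValue_nonneg hw M k) (fun M _ k => ?_) k⟩
  rw [bellman_eq, Nat.add_sub_cancel, optValue_eq_min hw M k]
  split_ifs with h
  · rw [min_eq_left h]
    simp
  · rw [min_eq_right (not_le.1 h).le]
    simp

/-- No deviation achieves less than the optimal value. -/
lemma ofReal_optValue_le_chainValue (S S' : Strategy) (hw : 0 ≤ w) (M k : ℕ) :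
    ENNReal.ofReal (optValue S w M k) ≤ chainValue S S' w M k := by
  have aux : ∀ N M k, M + k = N →
      ENNReal.ofReal (optValue S w M k) ≤ chainValue S S' w M k := by
    intro N
    induction N with
    | zero =>
      intro M k h
      obtain ⟨rfl, rfl⟩ : M = 0 ∧ k = 0 := by omega
      simp
    | succ N ih =>
      intro M k h
      have hp := (S' (M + 1) k).2
      have hq := (S (M + 1) k).2
      have hA := optValue_le_enter (S := S) hw M k
      have hB := optValue_le_stay (S := S) hw M k
      set V := optValue S w M k with hV
      have hV0 : 0 ≤ V := optValue_nonneg hw M k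
      rcases Nat.eq_zero_or_pos k with hk | hk
      · by_cases htop : chainValue S S' w M k = ⊤
        · rw [htop]
          exact le_top
        · set u := (chainValue S S' w M k).toReal with hu
          have hU : ENNReal.ofReal u = chainValue S S' w M k := ENNReal.ofReal_toReal htop
          have hu0 : 0 ≤ u := ENNReal.toReal_nonneg
          have step := ofReal_bellman_le_chainValue (S := S) (S' := S') hw (M := M) (k := k)
            (f := Function.update (fun e => optValue S w (M - e) (k + e - 1)) 0 u) (by
              intro e he
              rcases Nat.eq_zero_or_pos e with h0 | h0
              · subst h0 hk
                rw [Function.update_self, hU]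
                exact le_rfl
              · rw [Function.update_of_ne h0.ne']
                exact ih _ _ (by omega))
          rw [← hU, ENNReal.ofReal_le_ofReal_iff hu0, bellman_eq,
            stayCost_update _ (Nat.zero_le M)] at step
          rw [← hU]
          refine ENNReal.ofReal_le_ofReal ?_
          have hnext : optValue S w (M - 0) (k + 0 - 1) = V := by
            subst hk
            rfl
          simp only [hnext] at step
          -- If `u < V`, then entering and staying outside both cost more than `u`. For staying this
          -- uses that somebody else may enter; if nobody does, each further step costs `1`.
          by_contra hlt
          rw [not_le] at hlt
          have hr1 : binomialWeight M (S (M + 1) k) 0 ≤ 1 := by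
            rw [binomialWeight_zero_right]
            exact pow_le_one₀ (sub_nonneg.2 hq.2) (by linarith [hq.1])
          set r := binomialWeight M (S (M + 1) k) 0 with hr
          set B := stayCost (S (M + 1) k) M fun e => optValue S w (M - e) (k + e - 1) with hBdef
          have hB' : u < B + r * (u - V) := by
            rcases hr1.lt_or_eq with hr' | hr'
            · nlinarith
            · have hB1 : 1 + V ≤ B := by
                have := one_le_stayCost hq.1 hq.2 (M := M)
                  (f := Function.update (fun e => optValue S w (M - e) (k + e - 1)) 0 0) (by
                    intro e _
                    rcases Nat.eq_zero_or_pos e with h0 | h0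
                    · subst h0
                      simp
                    · rw [Function.update_of_ne h0.ne']
                      exact optValue_nonneg hw _ _)
                rw [stayCost_update _ (Nat.zero_le M)] at this
                simp only [hnext, ← hr, hr', ← hBdef] at this
                linarith
              rw [hr']
              linarith
          rcases hp.1.lt_or_eq with hp0 | hp0
          · nlinarith [mul_nonneg (sub_nonneg.2 hp.2) (sub_nonneg.2 hB'.le),
              mul_pos hp0 (sub_pos.2 (hlt.trans_le hA))]
          · rw [← hp0] at step
            linarith
      · have step := ofReal_bellman_le_chainValue (S := S) (S' := S') hw (M := M) (k := k)
          (f := fun e => optValue S w (M - e) (k + e - 1)) (fun e he => ih _ _ (by omega))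
        refine le_trans (ENNReal.ofReal_le_ofReal ?_) step
        rw [bellman_eq]
        nlinarith [mul_le_mul_of_nonneg_left hA hp.1,
          mul_le_mul_of_nonneg_left hB (sub_nonneg.2 hp.2)]
  exact aux _ _ _ rfl

/-- The optimal value is at most of order `√w`: the agent can wait for an empty queue and then
enter if the others enter with probability at most `1 / √w`, and let somebody else enter before him
otherwise. -/
lemma optValue_le (hw : 1 ≤ w) (M k : ℕ) : optValue S w M k ≤ k + (M + 1) * √w := by
  have hw0 : 0 ≤ w := zero_le_one.trans hw
  have hs : 1 ≤ √w := Real.one_le_sqrt.2 hw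
  have hsq : √w * √w = w := Real.mul_self_sqrt hw0
  have aux : ∀ N M k, M + k = N → optValue S w M k ≤ k + (M + 1) * √w := by
    intro N
    induction N with
    | zero =>
      intro M k h
      obtain ⟨rfl, rfl⟩ : M = 0 ∧ k = 0 := by omega
      simp
    | succ N ih =>
      intro M k h
      have hq := (S (M + 1) k).2
      have hA := optValue_le_enter (S := S) hw0 M k
      have hB := optValue_le_stay (S := S) hw0 M k
      rcases Nat.eq_zero_or_pos k with hk | hk
      · subst hk
        obtain ⟨M, rfl⟩ : ∃ M', M = M' + 1 := ⟨M - 1, by omega⟩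
        set q : ℝ := (S (M + 1 + 1) 0 : ℝ) with hqdef
        have hV0 := optValue_nonneg (S := S) hw0 (M + 1) 0
        set V := optValue S w (M + 1) 0 with hV
        push_cast at hA ⊢
        rcases le_total (q * √w) 1 with hqs | hqs
        · have : w * (0 + ((M : ℝ) + 1) * q / 2) = (M + 1) * √w * (q * √w) / 2 := by
            rw [← hsq]
            simp only [Real.sqrt_mul_self (Real.sqrt_nonneg w)]
            ring_nf
          have h2 : ((M : ℝ) + 1) * √w * (q * √w) ≤ (M + 1) * √w * 1 :=
            mul_le_mul_of_nonneg_left hqs (by positivity)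
          nlinarith [mul_nonneg (Nat.cast_nonneg (α := ℝ) M) (zero_le_one.trans hs)]
        · have hr : (1 - q) ^ (M + 1) ≤ 1 - q :=
            pow_le_of_le_one (sub_nonneg.2 hq.2) (by linarith [hq.1]) (Nat.succ_ne_zero M)
          have hle : stayCost q (M + 1)
              (fun e => optValue S w (M + 1 - e) (0 + e - 1))
              ≤ stayCost q (M + 1) (Function.update (fun _ => (M + 1) * √w) 0 V) := by
            refine stayCost_mono hq.1 hq.2 fun e he => ?_
            rcases e with _ | e
            · simp [hV]
            · rw [Function.update_of_ne (Nat.succ_ne_zero e)]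
              have h1 := ih (M + 1 - (e + 1)) (0 + (e + 1) - 1) (by omega)
              have h2 : (((M + 1 - (e + 1) : ℕ) : ℝ)) = M - e := by
                rw [Nat.add_sub_add_right, Nat.cast_sub (by omega)]
              have h3 : ((0 + (e + 1) - 1 : ℕ) : ℝ) = e := by
                simp
              rw [h2, h3] at h1
              nlinarith [mul_nonneg (Nat.cast_nonneg (α := ℝ) e) (sub_nonneg.2 hs)]
          rw [stayCost_update _ (Nat.zero_le _), stayCost_const, binomialWeight_zero_right] at hle
          have h4 := hB.trans hle
          by_contra hcon
          rw [not_le] at hcon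
          have hD : √w < V - (M + 1) * √w := by linarith
          have hqpos : 0 < q := by
            by_contra hq0
            nlinarith
          nlinarith [mul_le_mul_of_nonneg_right hr (hs.trans hD.le |>.trans' zero_le_one),
            mul_lt_mul_of_pos_left hD hqpos]
      · have hle : stayCost (S (M + 1) k) M (fun e => optValue S w (M - e) (k + e - 1))
            ≤ stayCost (S (M + 1) k) M (fun _ => (k - 1) + (M + 1) * √w) := by
          refine stayCost_mono hq.1 hq.2 fun e he => ?_
          have h1 := ih (M - e) (k + e - 1) (by omega)
          rw [Nat.cast_sub he, Nat.cast_sub (by omega)] at h1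
          push_cast at h1
          nlinarith [mul_nonneg (Nat.cast_nonneg (α := ℝ) e) (sub_nonneg.2 hs)]
        rw [stayCost_const] at hle
        linarith
  exact aux _ _ _ rfl

end OptValue

/-! ### The structure of equilibria -/

section Equilibrium

variable {S : Strategy} {w : ℝ}

/-- If playing `S` against itself is optimal with `M + 1` others outside and an empty queue, then
the agents randomize there, hence are indifferent between entering and staying outside; and `S` is
again optimal after the entry of one of the others. -/
lemma indifference_of_chainValue_eq (hw : 16 < w) (M : ℕ)
    (h : chainValue S S w (M + 1) 0 = ENNReal.ofReal (optValue S w (M + 1) 0)) :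
    0 < (S (M + 2) 0 : ℝ) ∧ optValue S w (M + 1) 0 = w * ((M + 1) * (S (M + 2) 0 : ℝ) / 2) ∧
      optValue S w (M + 1) 0 = stayCost (S (M + 2) 0) (M + 1)
        (fun e => optValue S w (M + 1 - e) (0 + e - 1)) ∧
      chainValue S S w M 0 = ENNReal.ofReal (optValue S w M 0) := by
  have hw0 : 0 ≤ w := by linarith
  have hq := (S (M + 2) 0).2
  have hA := optValue_le_enter (S := S) hw0 (M + 1) 0
  have hB := optValue_le_stay (S := S) hw0 (M + 1) 0
  have hup := optValue_le (S := S) (w := w) (by linarith) (M + 1) 0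
  have hV0 := optValue_nonneg (S := S) hw0 (M + 1) 0
  have hB1 : 1 ≤ stayCost (S (M + 1 + 1) 0) (M + 1)
      (fun e => optValue S w (M + 1 - e) (0 + e - 1)) :=
    one_le_stayCost hq.1 hq.2 fun e _ => optValue_nonneg hw0 _ _
  have hs : (4 : ℝ) < √w := by
    rw [show (4 : ℝ) = √16 by
      rw [show (16 : ℝ) = 4 ^ 2 by norm_num, Real.sqrt_sq (by norm_num)]]
    exact Real.sqrt_lt_sqrt (by norm_num) hw
  have hsq : √w * √w = w := Real.mul_self_sqrt hw0
  have key : ∀ x : ℝ, ENNReal.ofReal x ≤ chainValue S S w M 0 →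
      (S (M + 2) 0 : ℝ) * (w * (((0 : ℕ) : ℝ) + (M + 1 : ℕ) * (S (M + 2) 0 : ℝ) / 2)) +
        (1 - S (M + 2) 0) * (stayCost (S (M + 2) 0) (M + 1)
          (fun e => optValue S w (M + 1 - e) (0 + e - 1)) +
          (M + 1) * S (M + 2) 0 * (1 - S (M + 2) 0) ^ M * (x - optValue S w M 0))
        ≤ optValue S w (M + 1) 0 := by
    intro x hx
    have step := ofReal_bellman_le_chainValue (S := S) (S' := S) hw0 (M := M + 1) (k := 0)
      (f := Function.update (fun e => optValue S w (M + 1 - e) (0 + e - 1)) 1 x) (by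
        intro e he
        by_cases h1 : e = 1
        · subst h1
          rw [Function.update_self]
          exact hx
        · rw [Function.update_of_ne h1]
          exact ofReal_optValue_le_chainValue S S hw0 _ _)
    rw [h, ENNReal.ofReal_le_ofReal_iff hV0, bellman_eq, stayCost_update _ (by omega),
      binomialWeight_one_right] at step
    simpa using step
  have key0 := key _ (ofReal_optValue_le_chainValue S S hw0 M 0)
  rw [sub_self, mul_zero, add_zero] at key0
  set q : ℝ := (S (M + 2) 0 : ℝ) with hqdef
  set V := optValue S w (M + 1) 0 with hV
  set B := stayCost q (M + 1) (fun e => optValue S w (M + 1 - e) (0 + e - 1)) with hBdef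
  push_cast at hA hup key0 key
  rw [zero_add] at hA hup key0
  have hM : (0 : ℝ) ≤ M := Nat.cast_nonneg M
  have hq0 : 0 < q := by
    refine lt_of_le_of_ne hq.1 fun h0 => ?_
    rw [← h0] at hA
    rw [← h0] at key0
    have : B ≤ V := by linarith
    have : V ≤ 0 := by simpa using hA
    linarith
  have hq1 : q < 1 := by
    refine lt_of_le_of_ne hq.2 fun h1 => ?_
    rw [h1] at key0
    have h2 : w * (M + 1) ≤ 2 * ((M + 2) * √w) := by linarith
    nlinarith [mul_nonneg hM (zero_le_four.trans hs.le),
      mul_pos (sub_pos.2 hs) (zero_lt_four.trans hs),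
      mul_nonneg hM (mul_pos (sub_pos.2 hs) (zero_lt_four.trans hs)).le]
  have hAeq : V = w * ((M + 1) * q / 2) := by
    refine le_antisymm hA ?_
    by_contra hlt
    rw [not_le] at hlt
    nlinarith [mul_pos hq0 (sub_pos.2 hlt), mul_nonneg (sub_nonneg.2 hq1.le) (sub_nonneg.2 hB)]
  have hBeq : V = B := by
    refine le_antisymm hB ?_
    by_contra hlt
    rw [not_le] at hlt
    nlinarith [mul_pos (sub_pos.2 hq1) (sub_pos.2 hlt)]
  refine ⟨hq0, hAeq, hBeq, le_antisymm (iSup_le fun T => ENNReal.ofReal_le_ofReal ?_)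
    (ofReal_optValue_le_chainValue S S hw0 M 0)⟩
  have hx := key _ (le_iSup (fun T => ENNReal.ofReal (chainCost S S w T M 0)) T)
  by_contra hlt
  rw [not_le] at hlt
  rw [zero_add, ← hAeq, ← hBeq] at hx
  have hpos : 0 < (1 - q) * ((M + 1) * q * (1 - q) ^ M *
      (chainCost S S w T M 0 - optValue S w M 0)) := by
    have h1 : 0 < 1 - q := sub_pos.2 hq1
    have h2 := sub_pos.2 hlt
    positivity
  nlinarith

/-- In an equilibrium every state with empty queue is reached, so optimality propagates to all of
them. -/
lemma chainValue_eq_of_isSymmetricEquilibrium {n : ℕ} (hn : 0 < n) (hw : 16 < w)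
    (hS : IsSymmetricEquilibrium n w S) {M : ℕ} (hM : M ≤ n - 1) :
    chainValue S S w M 0 = ENNReal.ofReal (optValue S w M 0) := by
  have hw0 : 0 ≤ w := by linarith
  refine Nat.decreasingInduction (motive := fun M _ =>
    chainValue S S w M 0 = ENNReal.ofReal (optValue S w M 0)) ?_ ?_ hM
  · intro M _ ih
    exact (indifference_of_chainValue_eq hw M ih).2.2.2
  · refine le_antisymm ?_ (ofReal_optValue_le_chainValue S S hw0 _ 0)
    obtain ⟨S', hS'⟩ := exists_chainValue_le_optValue S hw0
    exact ((isSymmetricEquilibrium_iff S hw0 hn).1 hS S').trans (hS' _ _)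

end Equilibrium

/-! ### The cost of an equilibrium for large waiting costs -/

/-- The leading coefficient of the equilibrium cost of an agent, in units of `√w`, when `M` others
are outside and the queue is empty: the positive solution of `c² - c * c' = 1 / 2`, where `c'` is
the coefficient for `M - 1`. -/
def equilibriumCoeff : ℕ → ℝ
  | 0 => 0
  | M + 1 => (equilibriumCoeff M + √(equilibriumCoeff M ^ 2 + 2)) / 2

lemma equilibriumCoeff_nonneg (M : ℕ) : 0 ≤ equilibriumCoeff M := by
  induction M with
  | zero => exact le_rfl
  | succ M ih =>
    rw [equilibriumCoeff]
    positivity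

lemma equilibriumCoeff_succ_pos (M : ℕ) : 0 < equilibriumCoeff (M + 1) := by
  have := equilibriumCoeff_nonneg M
  rw [equilibriumCoeff]
  positivity

lemma equilibriumCoeff_succ_mul (M : ℕ) :
    equilibriumCoeff (M + 1) * (equilibriumCoeff (M + 1) - equilibriumCoeff M) = 1 / 2 := by
  have h : √(equilibriumCoeff M ^ 2 + 2) ^ 2 = equilibriumCoeff M ^ 2 + 2 :=
    Real.sq_sqrt (by positivity)
  rw [equilibriumCoeff]
  linear_combination h / 4

section Bounds

variable {S : Strategy} {w : ℝ}

lemma binomialWeight_one_succ_bounds {q : ℝ} (h0 : 0 ≤ q) (h1 : q ≤ 1) (M : ℕ) :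
    (M + 1) * q - (M + 1) ^ 2 * q ^ 2 ≤ binomialWeight (M + 1) q 1 ∧
      binomialWeight (M + 1) q 1 ≤ (M + 1) * q := by
  rw [binomialWeight_one_right, Nat.add_sub_cancel]
  push_cast
  have hM : (0 : ℝ) ≤ M := Nat.cast_nonneg M
  have hb := one_add_mul_le_pow (a := -q) (by linarith) M
  rw [← sub_eq_add_neg] at hb
  have hle : (1 - q) ^ M ≤ 1 := pow_le_one₀ (by linarith) (by linarith)
  have hpos : 0 ≤ ((M : ℝ) + 1) * q := by positivity
  constructor
  · nlinarith [mul_le_mul_of_nonneg_left hb hpos, mul_nonneg hpos h0]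
  · nlinarith

lemma pow_add_binomialWeight_one_le {q : ℝ} (h0 : 0 ≤ q) (h1 : q ≤ 1) (M : ℕ) :
    (1 - q) ^ (M + 1) + binomialWeight (M + 1) q 1 ≤ 1 := by
  have hsum := sum_binomialWeight (M + 1) q
  rw [Finset.sum_range_succ', Finset.sum_range_succ', binomialWeight_zero_right] at hsum
  have := Finset.sum_nonneg fun e (_ : e ∈ Finset.range M) =>
    binomialWeight_nonneg (M := M + 1) h0 h1 (e + 1 + 1)
  simp only [zero_add] at hsum
  linarith

/-- Up to entries of two or more of the others, whose probability is of second order in `q`, the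
cost of staying outside only involves the states with empty queue. -/
lemma stayCost_empty_queue_bounds {q : ℝ} (h0 : 0 ≤ q) (h1 : q ≤ 1) (M : ℕ) {f : ℕ → ℕ → ℝ}
    {b : ℝ} (hf0 : ∀ M k, 0 ≤ f M k) (hfb : ∀ e < M, f (M - 1 - e) (e + 1) ≤ b) :
    (1 - q) ^ (M + 1) * f (M + 1) 0 + 1 + binomialWeight (M + 1) q 1 * f M 0
        ≤ stayCost q (M + 1) (fun e => f (M + 1 - e) (0 + e - 1)) ∧
      stayCost q (M + 1) (fun e => f (M + 1 - e) (0 + e - 1))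
        ≤ (1 - q) ^ (M + 1) * f (M + 1) 0 + 1 + binomialWeight (M + 1) q 1 * f M 0 +
          (1 - (1 - q) ^ (M + 1) - binomialWeight (M + 1) q 1) * b := by
  rw [stayCost_empty_queue, Finset.sum_range_succ']
  have hsum := sum_binomialWeight (M + 1) q
  rw [Finset.sum_range_succ', Finset.sum_range_succ', binomialWeight_zero_right] at hsum
  have hterm : ∀ e, e + 1 ≤ M → M - (e + 1) = M - 1 - e := fun e _ => by omega
  have hlow : 0 ≤ ∑ e ∈ Finset.range M, binomialWeight (M + 1) q (e + 1 + 1) *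
      f (M - (e + 1)) (e + 1) :=
    Finset.sum_nonneg fun e _ => mul_nonneg (binomialWeight_nonneg h0 h1 _) (hf0 _ _)
  have hup : ∑ e ∈ Finset.range M, binomialWeight (M + 1) q (e + 1 + 1) *
      f (M - (e + 1)) (e + 1) ≤ (∑ e ∈ Finset.range M, binomialWeight (M + 1) q (e + 1 + 1)) * b := by
    rw [Finset.sum_mul]
    refine Finset.sum_le_sum fun e he => ?_
    rw [Finset.mem_range] at he
    refine mul_le_mul_of_nonneg_left ?_ (binomialWeight_nonneg h0 h1 _)
    rw [hterm e he]
    exact hfb e he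
  rw [show ∑ e ∈ Finset.range M, binomialWeight (M + 1) q (e + 1 + 1)
    = 1 - (1 - q) ^ (M + 1) - binomialWeight (M + 1) q 1 by
      rw [zero_add] at hsum
      linarith] at hup
  simp only [zero_add, Nat.sub_zero]
  constructor <;> linarith

/-- The recursion for the equilibrium cost, in units of `√w`: the relation
`x * (x - y) = 1 / 2` up to an error of order `1 / √w`. -/
lemma abs_optValue_recursion_le (hw : 16 < w) (M : ℕ)
    (h : chainValue S S w (M + 1) 0 = ENNReal.ofReal (optValue S w (M + 1) 0)) :
    |optValue S w (M + 1) 0 / √w * (optValue S w (M + 1) 0 / √w - optValue S w M 0 / √w) - 1 / 2|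
      ≤ 40 * (M + 1) ^ 3 / √w := by
  have hw0 : 0 ≤ w := by linarith
  have hs : 1 ≤ √w := Real.one_le_sqrt.2 (by linarith)
  have hs0 : 0 < √w := by linarith
  have hsq : √w * √w = w := Real.mul_self_sqrt hw0
  obtain ⟨hq0, hA, hB, -⟩ := indifference_of_chainValue_eq hw M h
  have hq1 := (S (M + 2) 0).2.2
  have hupV := optValue_le (S := S) (w := w) (by linarith) (M + 1) 0
  have hupM := optValue_le (S := S) (w := w) (by linarith) M 0
  have hV0 := optValue_nonneg (S := S) hw0 (M + 1) 0
  have hM0 := optValue_nonneg (S := S) hw0 M 0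
  have hM : (0 : ℝ) ≤ M := Nat.cast_nonneg M
  have hbounds := stayCost_empty_queue_bounds hq0.le hq1 M (f := optValue S w)
    (b := (M + 1) * √w) (fun M k => optValue_nonneg hw0 M k) (by
      intro e he
      have h1 := optValue_le (S := S) (w := w) (by linarith) (M - 1 - e) (e + 1)
      rw [Nat.sub_sub, Nat.cast_sub (by omega)] at h1
      push_cast at h1
      rw [Nat.sub_sub]
      nlinarith [mul_nonneg (Nat.cast_nonneg (α := ℝ) e) (sub_nonneg.2 hs)])
  rw [← hB] at hbounds
  obtain ⟨hb1, hb2⟩ := binomialWeight_one_succ_bounds hq0.le hq1 M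
  have hb3 := one_add_mul_le_pow (a := -(S (M + 2) 0 : ℝ)) (by linarith) (M + 1)
  rw [← sub_eq_add_neg] at hb3
  have hb4 : 0 ≤ 1 - (1 - (S (M + 2) 0 : ℝ)) ^ (M + 1)
      - binomialWeight (M + 1) (S (M + 2) 0 : ℝ) 1 := by
    linarith [pow_add_binomialWeight_one_le hq0.le hq1 M]
  set q : ℝ := (S (M + 2) 0 : ℝ) with hq
  set V := optValue S w (M + 1) 0 with hV
  set V' := optValue S w M 0 with hV'
  set b₁ := binomialWeight (M + 1) q 1 with hb₁
  set b₀ := (1 - q) ^ (M + 1) with hb₀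
  push_cast at hupV hupM hb3
  rw [zero_add] at hupV hupM
  -- Indifference determines `q` from the cost `V` of entering, so `q` is of order `1 / √w`.
  have hqs : q * √w ≤ 4 := by
    have h1 : √w * (M + 1) * (q * √w) ≤ √w * (M + 1) * 4 := by
      have : √w * (M + 1) * (q * √w) = 2 * V := by
        rw [hA, ← hsq]
        simp only [Real.sqrt_mul_self hs0.le]
        ring
      rw [this]
      nlinarith
    exact le_of_mul_le_mul_left h1 (by positivity)
  set η := ((M : ℝ) + 1) ^ 2 * q ^ 2 with hη
  have hη0 : 0 ≤ η := by positivity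
  set P := 1 - b₀ - b₁ with hP
  have hPη : P ≤ η := by linarith
  have hd0 : 0 ≤ (M + 1) * q - b₁ := by linarith
  have hdη : (M + 1) * q - b₁ ≤ η := by linarith
  have hlow : 0 ≤ V * (b₁ + P) - 1 - b₁ * V' := by
    have := hbounds.1
    simp only [hP]
    linarith
  have hhigh : V * (b₁ + P) - 1 - b₁ * V' ≤ P * ((M + 1) * √w) := by
    have := hbounds.2
    simp only [hP]
    linarith
  have hs1 : η * V ≤ η * ((M + 1 + 1) * √w) := mul_le_mul_of_nonneg_left hupV hη0
  have hs2 : η * V' ≤ η * ((M + 1) * √w) := mul_le_mul_of_nonneg_left hupM hη0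
  have hs3 : P * ((M + 1) * √w) ≤ η * ((M + 1) * √w) :=
    mul_le_mul_of_nonneg_right hPη (by positivity)
  have hs4 := mul_le_mul_of_nonneg_right hPη hV0
  have hs5 := mul_le_mul_of_nonneg_right hdη hV0
  have hs6 := mul_le_mul_of_nonneg_right hdη hM0
  have hs7 := mul_nonneg hb4 hV0
  have hs8 := mul_nonneg hd0 hV0
  have hs9 := mul_nonneg hd0 hM0
  have hMw : 0 ≤ η * (M * √w) := by positivity
  have hmain : |(M + 1) * q * (V - V') - 1| ≤ 5 * (M + 1) * √w * η := by
    rw [abs_le]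
    constructor <;> linarith
  have hηs : √w * η * √w ≤ 16 * (M + 1) ^ 2 := by
    have h1 : √w * η * √w = (M + 1) ^ 2 * (q * √w) ^ 2 := by
      rw [hη]
      ring
    have h2 : (q * √w) ^ 2 ≤ 4 ^ 2 := pow_le_pow_left₀ (by positivity) hqs 2
    rw [h1]
    nlinarith [sq_nonneg ((M : ℝ) + 1)]
  have hx : V / √w * (V / √w - V' / √w) - 1 / 2 = ((M + 1) * q * (V - V') - 1) / 2 := by
    have h1 : (M + 1) * q * w = 2 * V := by
      rw [hA]
      ring
    have h2 : V / √w * (V / √w - V' / √w) = V * (V - V') / w := by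
      rw [← sub_div, div_mul_div_comm, hsq]
    rw [h2, sub_div, show (M + 1) * q * (V - V') = (M + 1) * q * w * (V - V') / w by
      field_simp, h1]
    ring
  rw [hx, abs_div, abs_two, le_div_iff₀ hs0]
  have h5 := mul_le_mul_of_nonneg_right hmain hs0.le
  have h6 := mul_le_mul_of_nonneg_left hηs (show (0 : ℝ) ≤ 5 * (M + 1) by positivity)
  linarith

end Bounds

/-- The cost of an equilibrium is `equilibriumCoeff M * √w` up to a bounded error. -/
lemma exists_abs_optValue_sub_le (M : ℕ) : ∃ B : ℝ, ∀ (w : ℝ) (S : Strategy), 16 < w →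
    chainValue S S w M 0 = ENNReal.ofReal (optValue S w M 0) →
    |optValue S w M 0 - equilibriumCoeff M * √w| ≤ B := by
  induction M with
  | zero =>
    refine ⟨0, fun w S _ _ => ?_⟩
    simp [equilibriumCoeff]
  | succ M ih =>
    obtain ⟨B, hB⟩ := ih
    set c := equilibriumCoeff (M + 1) with hc
    set c' := equilibriumCoeff M with hc'
    have hcpos : 0 < c := equilibriumCoeff_succ_pos M
    have hcc : c * (c - c') = 1 / 2 := equilibriumCoeff_succ_mul M
    refine ⟨2 * c * (40 * (M + 1) ^ 3 + (M + 2) * B), fun w S hw h => ?_⟩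
    have hw0 : 0 ≤ w := by linarith
    have hs0 : 0 < √w := Real.sqrt_pos.2 (by linarith)
    have hrec := abs_optValue_recursion_le hw M h
    have hy := hB w S hw (indifference_of_chainValue_eq hw M h).2.2.2
    have hV0 := optValue_nonneg (S := S) hw0 (M + 1) 0
    have hup := optValue_le (S := S) (w := w) (by linarith) (M + 1) 0
    push_cast at hup
    rw [zero_add] at hup
    set x := optValue S w (M + 1) 0 / √w with hx
    set y := optValue S w M 0 / √w with hyd
    have hx0 : 0 ≤ x := by positivity
    have hxM : x ≤ M + 2 := by
      rw [hx, div_le_iff₀ hs0]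
      linarith
    have hyB : |y - c'| ≤ B / √w := by
      have h1 : |y - c'| * √w = |optValue S w M 0 - c' * √w| := by
        nth_rewrite 1 [← abs_of_pos hs0]
        rw [← abs_mul, sub_mul, hyd, div_mul_cancel₀ _ hs0.ne']
      rw [le_div_iff₀ hs0, h1]
      exact hy
    have hkey : (x - c) * (x + (c - c')) = (x * (x - y) - 1 / 2) + x * (y - c') := by
      linear_combination -hcc
    have hd : c - c' = 1 / (2 * c) := by
      field_simp
      linarith
    have hdpos : 0 < c - c' := by
      rw [hd]
      positivity
    have h1 : |x - c| * (c - c') ≤ 40 * (M + 1) ^ 3 / √w + (M + 2) * (B / √w) := by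
      calc |x - c| * (c - c') ≤ |x - c| * |x + (c - c')| := by
            refine mul_le_mul_of_nonneg_left ?_ (abs_nonneg _)
            rw [abs_of_nonneg (by linarith)]
            linarith
        _ = |(x * (x - y) - 1 / 2) + x * (y - c')| := by rw [← abs_mul, hkey]
        _ ≤ |x * (x - y) - 1 / 2| + |x * (y - c')| := abs_add_le _ _
        _ ≤ 40 * (M + 1) ^ 3 / √w + (M + 2) * (B / √w) := by
            refine add_le_add hrec ?_
            rw [abs_mul, abs_of_nonneg hx0]
            exact mul_le_mul hxM hyB (abs_nonneg _) (by positivity)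
    have h2 : |optValue S w (M + 1) 0 - c * √w| = |x - c| * √w := by
      nth_rewrite 2 [← abs_of_pos hs0]
      rw [← abs_mul, sub_mul, hx, div_mul_cancel₀ _ hs0.ne']
    rw [h2]
    have h3 : |x - c| * √w = 2 * c * ((|x - c| * (c - c')) * √w) := by
      rw [hd]
      field_simp
    have h4 := mul_le_mul_of_nonneg_right h1 hs0.le
    rw [add_mul, div_mul_cancel₀ _ hs0.ne', mul_assoc (M + 2 : ℝ),
      div_mul_cancel₀ _ hs0.ne'] at h4
    rw [h3]
    exact mul_le_mul_of_nonneg_left h4 (by positivity)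

/-! ### The optimal social cost for large waiting costs -/

/-- The leading coefficient of the optimal social cost, in units of `√w`, when `M + 1` agents are
outside and the queue is empty: while `j + 1` agents are outside, the optimal compromise between
slow entry and collisions costs `√(2 * j)`. -/
def optCoeff (M : ℕ) : ℝ := ∑ j ∈ Finset.range (M + 1), √(2 * j)

@[simp] lemma optCoeff_zero : optCoeff 0 = 0 := by simp [optCoeff]

lemma optCoeff_succ (M : ℕ) : optCoeff (M + 1) = optCoeff M + √(2 * (M + 1)) := by
  rw [optCoeff, Finset.sum_range_succ, ← optCoeff]
  push_cast
  rfl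

lemma optCoeff_nonneg (M : ℕ) : 0 ≤ optCoeff M :=
  Finset.sum_nonneg fun _ _ => Real.sqrt_nonneg _

lemma optCoeff_le (M : ℕ) : optCoeff M ≤ (M + 1) * √(2 * (M + 1)) := by
  induction M with
  | zero => simp
  | succ M ih =>
    rw [optCoeff_succ]
    have h : √(2 * ((M : ℝ) + 1)) ≤ √(2 * ((M + 1 : ℕ) + 1)) := by
      refine Real.sqrt_le_sqrt ?_
      push_cast
      linarith
    push_cast at h ⊢
    have hM : (0 : ℝ) ≤ M := Nat.cast_nonneg M
    nlinarith

/-- The social cost of every strategy is at least `optCoeff M * √w` up to a bounded error, hence the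
cost of an agent at least the `(M + 1)`-st part of that: collisions of
two agents and the time until the first entry alone cost that much. -/
lemma exists_le_chainValue (M : ℕ) : ∃ D : ℝ, 0 ≤ D ∧ ∀ (w : ℝ) (S : Strategy), 0 ≤ w →
    ENNReal.ofReal ((optCoeff M * √w - D) / (M + 1)) ≤ chainValue S S w M 0 := by
  induction M with
  | zero =>
    refine ⟨0, le_rfl, fun w S _ => ?_⟩
    simp
  | succ M ih =>
    obtain ⟨D, hD0, hD⟩ := ih
    set τ := optCoeff M with hτ
    have hτ0 : 0 ≤ τ := optCoeff_nonneg M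
    set a := √(2 * ((M : ℝ) + 1)) with ha
    have ha0 : 0 ≤ a := Real.sqrt_nonneg _
    have hM : (0 : ℝ) ≤ M := Nat.cast_nonneg M
    have haa : a * a = 2 * (M + 1) := Real.mul_self_sqrt (by positivity)
    refine ⟨D + 1 + 2 * a * τ + 2 * τ ^ 2, by positivity, fun w S hw => ?_⟩
    by_cases htop : chainValue S S w (M + 1) 0 = ⊤
    · rw [htop]
      exact le_top
    set u := (chainValue S S w (M + 1) 0).toReal with hu
    have hU : ENNReal.ofReal u = chainValue S S w (M + 1) 0 := ENNReal.ofReal_toReal htop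
    have hu0 : 0 ≤ u := ENNReal.toReal_nonneg
    set l := max (τ * √w - D) 0 with hl
    have hl0 : 0 ≤ l := le_max_right _ _
    have hlD : τ * √w - D ≤ l := le_max_left _ _
    have hlτ : l ≤ τ * √w := max_le (by linarith) (by positivity)
    have hl' : ENNReal.ofReal (l / (M + 1)) ≤ chainValue S S w M 0 := by
      rcases max_choice (τ * √w - D) 0 with h | h
      · rw [hl, h]
        exact hD w S hw
      · rw [hl, h]
        simp
    have hq := (S (M + 2) 0).2
    have step := ofReal_bellman_le_chainValue (S := S) (S' := S) hw (M := M + 1) (k := 0)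
      (f := Function.update (Function.update (fun _ => 0) 0 u) 1 (l / (M + 1))) (by
        intro e he
        rcases e with _ | _ | e
        · simp [hU]
        · simpa using hl'
        · simp [Function.update_of_ne])
    rw [← hU, ENNReal.ofReal_le_ofReal_iff hu0, bellman_eq, stayCost_update _ (by omega),
      stayCost_update _ (by omega), stayCost_const, binomialWeight_zero_right,
      binomialWeight_one_right, Nat.add_sub_cancel, Function.update_of_ne one_ne_zero] at step
    rw [← hU]
    refine ENNReal.ofReal_le_ofReal ?_
    push_cast at step ⊢
    rw [optCoeff_succ, ← hτ, ← ha, div_le_iff₀ (by positivity)]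
    set q : ℝ := (S (M + 2) 0 : ℝ) with hqdef
    change q * (w * (0 + ((M : ℝ) + 1) * q / 2)) + (1 - q) *
      (1 + 0 + (1 - q) ^ (M + 1) * (u - 0) + ((M : ℝ) + 1) * q * (1 - q) ^ M *
        (l / (M + 1) - 0)) ≤ u at step
    have hcancel : ((M : ℝ) + 1) * q * (1 - q) ^ M * (l / (M + 1) - 0) = q * (1 - q) ^ M * l := by
      field_simp
      ring
    rw [hcancel] at step
    have hb1 := one_add_mul_le_pow (a := -q) (by linarith [hq.2]) (M + 2)
    have hb2 := one_add_mul_le_pow (a := -q) (by linarith [hq.2]) (M + 1)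
    rw [← sub_eq_add_neg] at hb1 hb2
    push_cast at hb1 hb2
    by_contra hlt
    rw [not_le] at hlt
    have hs0 : 0 ≤ √w := Real.sqrt_nonneg w
    have hsq : √w * √w = w := Real.mul_self_sqrt hw
    -- By Bernoulli's inequality the recursion takes a form that can be divided by `q`.
    have h1 : w * (M + 1) * q ^ 2 / 2 + (1 - q) + q * l * (1 - (M + 1) * q)
        ≤ q * (u * (M + 1 + 1)) := by
      have e1 : (1 - q) * (q * (1 - q) ^ M * l) = q * l * (1 - q) ^ (M + 1) := by ring
      have e2 : (1 - q) * ((1 - q) ^ (M + 1) * u) = (1 - q) ^ (M + 2) * u := by ring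
      have h2 := mul_le_mul_of_nonneg_left hb2 (mul_nonneg hq.1 hl0)
      have h3 := mul_le_mul_of_nonneg_right hb1 hu0
      nlinarith
    have hq0 : 0 < q := by
      refine lt_of_le_of_ne hq.1 fun h0 => ?_
      rw [← h0] at h1
      norm_num at h1
    have h4 : q * (w * (M + 1) * q / 2 + 1 / q - 1 + l * (1 - (M + 1) * q))
        ≤ q * (u * (M + 1 + 1)) := by
      refine le_trans (le_of_eq ?_) h1
      field_simp
      ring
    have h5 := le_of_mul_le_mul_left h4 hq0
    rcases le_total (2 * τ) √w with hτs | hτs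
    · -- The arithmetic-geometric mean inequality for entry time and collision cost.
      have hamgm : a * (√w - 2 * τ) ≤ (M + 1) * q * (√w - 2 * τ) ^ 2 / 2 + 1 / q := by
        have h6 : q * (a * (√w - 2 * τ)) ≤ q * ((M + 1) * q * (√w - 2 * τ) ^ 2 / 2 + 1 / q) := by
          have : q * ((M + 1) * q * (√w - 2 * τ) ^ 2 / 2 + 1 / q)
              = (M + 1) * q ^ 2 * (√w - 2 * τ) ^ 2 / 2 + 1 := by
            field_simp
          rw [this]
          have h7 := sq_nonneg (a * q * (√w - 2 * τ) / 2 - 1)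
          have h8 : (a * q * (√w - 2 * τ) / 2) ^ 2
              = (M + 1) * q ^ 2 * (√w - 2 * τ) ^ 2 / 2 := by
            have : (a * q * (√w - 2 * τ) / 2) ^ 2
              = (a * a) * (q ^ 2 * (√w - 2 * τ) ^ 2) / 4 := by ring
            rw [this, haa]
            ring
          nlinarith
        exact le_of_mul_le_mul_left h6 hq0
      have h9 : (√w - 2 * τ) ^ 2 / 2 ≤ w / 2 - τ * √w := by
        nlinarith
      have hNq : 0 ≤ ((M : ℝ) + 1) * q := by positivity
      have h10 := mul_le_mul_of_nonneg_left h9 hNq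
      have h11 := mul_le_mul_of_nonneg_left hlτ hNq
      linarith [sq_nonneg τ]
    · have h12 : 0 ≤ u * (M + 1 + 1) := by positivity
      linarith [mul_le_mul_of_nonneg_left hτs ha0, mul_le_mul_of_nonneg_left hτs hτ0]

/-! ### A nearly optimal strategy -/

/-- The entry probability with which `M + 1` agents outside an empty queue should enter: it
minimizes the sum of the expected waiting time `1 / q` and the expected collision cost
`M * q * w / 2`. -/
def goodEntryProb (w : ℝ) (M : ℕ) : ℝ := √(2 / (M * w))

/-- The strategy that never enters a nonempty queue, and enters an empty one with probability
`goodEntryProb`, or surely if nobody else is outside. -/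
def goodStrategy (w : ℝ) : Strategy := fun m k =>
  if k = 0 then (if m ≤ 1 then 1 else Set.projIcc 0 1 zero_le_one (goodEntryProb w (m - 1))) else 0

/-- The constant term of an upper bound for the social cost of `goodStrategy`. -/
def goodError : ℕ → ℝ
  | 0 => 0
  | M + 1 => 2 * goodError M + 4 * (M + 1) ^ 2 + 2 * (√(2 * (M + 1)) * optCoeff (M + 1))

lemma goodError_nonneg (M : ℕ) : 0 ≤ goodError M := by
  induction M with
  | zero => exact le_rfl
  | succ M ih =>
    have := optCoeff_nonneg (M + 1)
    rw [goodError]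
    positivity

/-- An upper bound for the cost of an agent under `goodStrategy`, when `M` others are outside and
the queue is empty. -/
def goodBound (w : ℝ) (M : ℕ) : ℝ := (optCoeff M * √w + goodError M) / (M + 1)

lemma goodBound_nonneg (w : ℝ) (M : ℕ) : 0 ≤ goodBound w M := by
  have h1 := optCoeff_nonneg M
  have h2 := goodError_nonneg M
  unfold goodBound
  positivity

lemma goodBound_le_succ (w : ℝ) (M : ℕ) : goodBound w M ≤ goodBound w (M + 1) := by
  have hM : (0 : ℝ) ≤ M := Nat.cast_nonneg M
  have h1 := optCoeff_le M
  have h2 := goodError_nonneg M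
  have h3 := optCoeff_nonneg (M + 1)
  have h4 := Real.sqrt_nonneg w
  have h5 := Real.sqrt_nonneg (2 * ((M : ℝ) + 1))
  have h6 : 0 ≤ √(2 * ((M : ℝ) + 1)) * optCoeff (M + 1) := by positivity
  unfold goodBound
  rw [div_le_div_iff₀ (by positivity) (by positivity)]
  rw [goodError, optCoeff_succ] at *
  push_cast
  have h7 : 0 ≤ goodError M * M := by positivity
  have h8 := mul_le_mul_of_nonneg_right h1 h4
  have h9 : 0 ≤ ((M : ℝ) + 1) * (4 * (M + 1) ^ 2 +
    2 * (√(2 * ((M : ℝ) + 1)) * (optCoeff M + √(2 * (M + 1))))) := by positivity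
  nlinarith

lemma monotone_goodBound (w : ℝ) : Monotone (goodBound w) :=
  monotone_nat_of_le_succ (goodBound_le_succ w)

lemma stayCost_zero (M : ℕ) (f : ℕ → ℝ) : stayCost 0 M f = 1 + f 0 := by
  rw [stayCost, Finset.sum_range_succ']
  simp [binomialWeight]

/-- The cost of staying outside if the later costs are those of waiting for an empty queue and then
at most `b`, except that they are `a` if nobody enters. -/
lemma stayCost_le_of_wait {q : ℝ} (h0 : 0 ≤ q) (h1 : q ≤ 1) (M : ℕ) {a b : ℝ} {f : ℕ → ℝ}
    (hfa : f 0 ≤ a) (hfb : ∀ e, f (e + 1) ≤ e + b) :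
    stayCost q M f ≤ 1 + b + (1 - q) ^ M * (a - b) + M ^ 2 * q ^ 2 := by
  have hle : stayCost q M f ≤ stayCost q M
      (Function.update (fun e => (e : ℝ) * (e - 1) + b) 0 a) := by
    refine stayCost_mono h0 h1 fun e _ => ?_
    rcases e with _ | e
    · simpa using hfa
    · rw [Function.update_of_ne (Nat.succ_ne_zero e)]
      refine (hfb e).trans ?_
      push_cast
      nlinarith [mul_nonneg (Nat.cast_nonneg (α := ℝ) e) (Nat.cast_nonneg (α := ℝ) e)]
  rw [stayCost_update _ (Nat.zero_le M), binomialWeight_zero_right] at hle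
  have hsum : stayCost q M (fun e => (e : ℝ) * (e - 1) + b) = 1 + (M * (M - 1) * q ^ 2 + b) := by
    simp only [stayCost, mul_add, Finset.sum_add_distrib]
    rw [sum_binomialWeight_mul_mul_sub_one, ← Finset.sum_mul, sum_binomialWeight, one_mul]
  rw [hsum] at hle
  simp only [Nat.cast_zero, zero_mul, zero_add] at hle
  nlinarith [mul_nonneg (Nat.cast_nonneg (α := ℝ) M) (sq_nonneg q)]

/-- The recursion for `goodBound`, divided by the entry probability. -/
lemma goodBound_step {w : ℝ} (hw : 0 < w) (M : ℕ) (hMw : 4 * ((M : ℝ) + 1) ≤ √w) {q : ℝ}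
    (hq : q = goodEntryProb w (M + 1)) :
    0 < q ∧ q ≤ 1 ∧ w * (M + 1) * q / 2 + 1 / q + (M + 1) * goodBound w M + (M + 1) ^ 2 * q
      ≤ (M + 2) * (1 - (M + 1) * q) * goodBound w (M + 1) := by
  have hM : (0 : ℝ) ≤ M := Nat.cast_nonneg M
  have hs0 : 0 < √w := Real.sqrt_pos.2 hw
  have hsq : √w * √w = w := Real.mul_self_sqrt hw.le
  set a := √(2 * ((M : ℝ) + 1)) with ha
  have ha0 : 0 < a := Real.sqrt_pos.2 (by positivity)
  have haa : a * a = 2 * (M + 1) := Real.mul_self_sqrt (by positivity)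
  have ha1 : 1 ≤ a := Real.one_le_sqrt.2 (by linarith)
  have ha2 : a ≤ 2 * (M + 1) := by nlinarith
  have hqa : q = a / ((M + 1) * √w) := by
    rw [hq, goodEntryProb]
    refine (Real.sqrt_eq_iff_mul_self_eq (by positivity) (by positivity)).2 ?_
    rw [div_mul_div_comm, haa]
    push_cast
    rw [show ((M : ℝ) + 1) * √w * ((M + 1) * √w) = (M + 1) * (M + 1) * (√w * √w) by ring, hsq]
    field_simp
  have hq0 : 0 < q := by
    rw [hqa]
    positivity
  have hNq : (M + 1) * q * √w = a := by
    rw [hqa]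
    field_simp
  have hNq2 : (M + 1) * q ≤ 1 / 2 := by
    have : (M + 1) * q * √w ≤ 1 / 2 * √w := by
      rw [hNq]
      linarith
    exact le_of_mul_le_mul_right this hs0
  have hq1 : q ≤ 1 := by nlinarith
  refine ⟨hq0, hq1, ?_⟩
  have e1 : w * (M + 1) * q / 2 = a * √w / 2 := by
    rw [← hNq]
    linear_combination -((M + 1) * q / 2) * hsq
  have e2 : 1 / q = a * √w / 2 := by
    rw [hqa]
    field_simp
    linarith
  have e3 : (M + 1) * goodBound w M = optCoeff M * √w + goodError M := by
    rw [goodBound]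
    field_simp
  have e4 : (M + 2) * goodBound w (M + 1) = (optCoeff M + a) * √w + goodError (M + 1) := by
    rw [goodBound, optCoeff_succ, ← ha]
    push_cast
    rw [show (M : ℝ) + 1 + 1 = M + 2 by ring]
    field_simp
  have hC : goodError (M + 1)
      = 2 * goodError M + 4 * (M + 1) ^ 2 + 2 * (a * (optCoeff M + a)) := by
    rw [goodError, optCoeff_succ]
  have hC0 := goodError_nonneg (M + 1)
  have hE : ((M : ℝ) + 1) ^ 2 * q ≤ (M + 1) ^ 2 := mul_le_of_le_one_right (by positivity) hq1
  rw [show ((M : ℝ) + 2) * (1 - (M + 1) * q) * goodBound w (M + 1)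
    = (1 - (M + 1) * q) * ((M + 2) * goodBound w (M + 1)) by ring, e1, e2, e3, e4]
  have e5 : (M + 1) * q * ((optCoeff M + a) * √w) = a * (optCoeff M + a) := by
    rw [← hNq]
    ring
  have h6 := mul_le_mul_of_nonneg_right hNq2 hC0
  nlinarith

lemma chainValue_goodStrategy_le {w : ℝ} (hw : 0 < w) (M₀ : ℕ) (hMw : 4 * (M₀ : ℝ) ≤ √w) :
    chainValue (goodStrategy w) (goodStrategy w) w M₀ 0 ≤ ENNReal.ofReal (goodBound w M₀) := by
  have key := chainValue_le_of_bellman_le (S := goodStrategy w) (S' := goodStrategy w) (w := w)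
    (Φ := fun M k => k + goodBound w M) (M₀ := M₀)
    (fun M k => add_nonneg (Nat.cast_nonneg k) (goodBound_nonneg w M)) (fun M hM k => ?_) 0
  · simpa using key
  rcases k with _ | k
  · rcases M with _ | M
    · simp [goodStrategy, bellman_eq, goodBound, goodError]
    · have hMw' : 4 * ((M : ℝ) + 1) ≤ √w := by
        have : ((M + 1 : ℕ) : ℝ) ≤ M₀ := by exact_mod_cast hM
        push_cast at this
        linarith
      obtain ⟨hq0, hq1, hstep⟩ := goodBound_step hw M hMw' rfl
      have hval : ((goodStrategy w (M + 1 + 1) 0 : unitInterval) : ℝ)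
          = goodEntryProb w (M + 1) := by
        simp only [goodStrategy, if_true, Nat.add_sub_cancel]
        rw [if_neg (by omega), Set.projIcc_of_mem zero_le_one ⟨hq0.le, hq1⟩]
      rw [hval]
      set q := goodEntryProb w (M + 1) with hq
      have hstay := stayCost_le_of_wait hq0.le hq1 (M + 1) (a := goodBound w (M + 1))
        (b := goodBound w M)
        (f := fun e => ((0 + e - 1 : ℕ) : ℝ) + goodBound w (M + 1 - e)) (by simp) (by
          intro e
          have h1 : 0 + (e + 1) - 1 = e := by omega
          simp only [h1]
          exact add_le_add_right (monotone_goodBound w (by omega)) _)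
      rw [bellman_eq]
      have h2 := mul_le_mul_of_nonneg_left hstay (sub_nonneg.2 hq1)
      refine (add_le_add_right h2 _).trans ?_
      have h3 := mul_le_mul_of_nonneg_left hstep hq0.le
      have h4 : (M + 2) * q * (1 - (M + 1) * q) ≤ 1 - (1 - q) ^ (M + 2) := by
        have h5 := pow_add_binomialWeight_one_le hq0.le hq1 (M + 1)
        rw [binomialWeight_one_right, Nat.add_sub_cancel] at h5
        have h6 := one_add_mul_le_pow (a := -q) (by linarith) (M + 1)
        rw [← sub_eq_add_neg] at h6
        push_cast at h5 h6
        have h7 : 0 ≤ ((M : ℝ) + 2) * q := by positivity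
        have h8 := mul_le_mul_of_nonneg_left h6 h7
        linarith
      have h5 := mul_le_mul_of_nonneg_right h4 (goodBound_nonneg w (M + 1))
      have h6 : (1 - q) * (1 - (1 - q) ^ (M + 1)) ≤ (M + 1) * q := by
        have h7 := one_add_mul_le_pow (a := -q) (by linarith) (M + 1)
        rw [← sub_eq_add_neg] at h7
        push_cast at h7
        have h8 : 0 ≤ 1 - (1 - q) ^ (M + 1) :=
          sub_nonneg.2 (pow_le_one₀ (by linarith) (by linarith))
        linarith [mul_nonneg hq0.le h8]
      have h7 := mul_le_mul_of_nonneg_right h6 (goodBound_nonneg w M)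
      have h8 : q * (1 / q) = 1 := mul_one_div_cancel hq0.ne'
      have h9 : 0 ≤ q * (((M : ℝ) + 1) ^ 2 * q ^ 2) := by positivity
      have h10 : (1 - q) * (1 - q) ^ (M + 1) = (1 - q) ^ (M + 2) := by ring
      set G := goodBound w M with hG
      set G' := goodBound w (M + 1) with hG'
      have h11 : (1 - q) * (1 + G + (1 - q) ^ (M + 1) * (G' - G) + ((M + 1 : ℕ) : ℝ) ^ 2 * q ^ 2)
          = (1 - q) + (1 - q) * (1 - (1 - q) ^ (M + 1)) * G + (1 - q) ^ (M + 2) * G'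
            + ((M : ℝ) + 1) ^ 2 * q ^ 2 - q * (((M : ℝ) + 1) ^ 2 * q ^ 2) := by
        rw [← h10]
        push_cast
        ring
      rw [h11]
      push_cast
      have h12 : q * (w * (M + 1) * q / 2 + 1 / q + (M + 1) * G + (M + 1) ^ 2 * q)
          = q * (w * (0 + (M + 1) * q / 2)) + q * (1 / q) + (M + 1) * q * G
            + (M + 1) ^ 2 * q ^ 2 := by ring
      rw [h12, h8] at h3
      linarith
  · simp [goodStrategy, bellman_eq, stayCost_zero]
    linarith

/-! ### Asymptotics of the two coefficients -/

lemma equilibriumCoeff_succ_sq (M : ℕ) : equilibriumCoeff (M + 1) ^ 2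
    = equilibriumCoeff M ^ 2 + 1 - 1 / (4 * equilibriumCoeff (M + 1) ^ 2) := by
  have h := equilibriumCoeff_succ_mul M
  have hpos := equilibriumCoeff_succ_pos M
  set c := equilibriumCoeff (M + 1)
  have hc' : equilibriumCoeff M = c - 1 / (2 * c) := by
    field_simp
    linarith
  rw [hc']
  field_simp
  ring

lemma half_le_equilibriumCoeff_sq (M : ℕ) : (M : ℝ) / 2 ≤ equilibriumCoeff M ^ 2 := by
  induction M with
  | zero => simp [equilibriumCoeff]
  | succ M ih =>
    have h := equilibriumCoeff_succ_mul M
    have hpos := equilibriumCoeff_succ_pos M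
    have hnn := equilibriumCoeff_nonneg M
    have h1 : 1 / 2 ≤ equilibriumCoeff (M + 1) ^ 2 := by nlinarith
    have h2 : 1 / (4 * equilibriumCoeff (M + 1) ^ 2) ≤ 1 / 2 := by
      rw [div_le_div_iff₀ (by positivity) (by norm_num)]
      linarith
    rw [equilibriumCoeff_succ_sq]
    push_cast
    linarith

lemma equilibriumCoeff_sq_le (M : ℕ) : equilibriumCoeff M ^ 2 ≤ M := by
  induction M with
  | zero => simp [equilibriumCoeff]
  | succ M ih =>
    have hpos := equilibriumCoeff_succ_pos M
    have h2 : 0 ≤ 1 / (4 * equilibriumCoeff (M + 1) ^ 2) := by positivity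
    rw [equilibriumCoeff_succ_sq]
    push_cast
    linarith

lemma le_equilibriumCoeff_sq (M : ℕ) : (M : ℝ) - 2 * √M ≤ equilibriumCoeff M ^ 2 := by
  induction M with
  | zero => simp [equilibriumCoeff]
  | succ M ih =>
    have hM : (0 : ℝ) ≤ M := Nat.cast_nonneg M
    have h1 := half_le_equilibriumCoeff_sq (M + 1)
    have hpos := equilibriumCoeff_succ_pos M
    rw [equilibriumCoeff_succ_sq]
    push_cast at h1 ⊢
    have h2 : 1 / (4 * equilibriumCoeff (M + 1) ^ 2) ≤ 1 / (2 * (M + 1)) := by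
      apply one_div_le_one_div_of_le <;> linarith
    set a := √(M : ℝ) with ha
    set b := √((M : ℝ) + 1) with hb
    have ha0 : 0 ≤ a := Real.sqrt_nonneg _
    have haa : a * a = M := Real.mul_self_sqrt hM
    have hbb : b * b = M + 1 := Real.mul_self_sqrt (by linarith)
    have hb1 : 1 ≤ b := Real.one_le_sqrt.2 (by linarith)
    have hab : a ≤ b := Real.sqrt_le_sqrt (by linarith)
    have h3 : 1 / (2 * ((M : ℝ) + 1)) ≤ 2 * (b - a) := by
      rw [← hbb, div_le_iff₀ (by positivity)]
      have h4 : (b - a) * (b + a) = 1 := by linear_combination hbb - haa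
      nlinarith [mul_nonneg (sub_nonneg.2 hab) (sub_nonneg.2 hb1)]
    linarith

/-- With `M + 1 = n` agents, the equilibrium coefficient is `√n` up to a bounded error. -/
lemma abs_equilibriumCoeff_sub_sqrt_le (M : ℕ) :
    |equilibriumCoeff M - √((M : ℝ) + 1)| ≤ 3 := by
  have hM : (0 : ℝ) ≤ M := Nat.cast_nonneg M
  have h1 := equilibriumCoeff_sq_le M
  have h2 := le_equilibriumCoeff_sq M
  have h0 := equilibriumCoeff_nonneg M
  have hbb : √((M : ℝ) + 1) * √((M : ℝ) + 1) = M + 1 := Real.mul_self_sqrt (by linarith)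
  have hb1 : 1 ≤ √((M : ℝ) + 1) := Real.one_le_sqrt.2 (by linarith)
  have hab : √(M : ℝ) ≤ √((M : ℝ) + 1) := Real.sqrt_le_sqrt (by linarith)
  rw [abs_le]
  constructor <;> nlinarith

lemma optCoeff_bounds (M : ℕ) :
    √2 * (2 / 3 * ((M : ℝ) + 1) * √((M : ℝ) + 1) - √((M : ℝ) + 1)) ≤ optCoeff M ∧
      optCoeff M ≤ √2 * (2 / 3 * ((M : ℝ) + 1) * √((M : ℝ) + 1)) := by
  induction M with
  | zero => norm_num
  | succ M ih =>
    have hM : (0 : ℝ) ≤ M := Nat.cast_nonneg M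
    rw [optCoeff_succ, Real.sqrt_mul (by norm_num : (0 : ℝ) ≤ 2)]
    push_cast
    set a := √((M : ℝ) + 1) with ha
    set b := √((M : ℝ) + 1 + 1) with hb
    have ha0 : 0 ≤ a := Real.sqrt_nonneg _
    have haa : a * a = M + 1 := Real.mul_self_sqrt (by linarith)
    have hbb : b * b = M + 1 + 1 := Real.mul_self_sqrt (by linarith)
    have hab : a ≤ b := Real.sqrt_le_sqrt (by linarith)
    have h2 : 0 ≤ √(2 : ℝ) := Real.sqrt_nonneg 2
    have h4 : (b - a) * (b + a) = 1 := by linear_combination hbb - haa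
    have e : 2 / 3 * (b * b * b - a * a * a) = 2 / 3 * (b - a) * (b * b + a * b + a * a) := by
      ring
    have hd : 0 ≤ b - a := sub_nonneg.2 hab
    have hlo : a ≤ 2 / 3 * (b * b * b - a * a * a) := by
      have e1 : 2 / 3 * (b * b * b - a * a * a) - a * ((b - a) * (b + a))
          = (b - a) ^ 2 * (2 * b + a) / 3 := by ring
      have : 0 ≤ (b - a) ^ 2 * (2 * b + a) / 3 := by positivity
      rw [h4] at e1
      linarith
    have hhi : 2 / 3 * (b * b * b - a * a * a) ≤ b := by
      have e1 : b * ((b - a) * (b + a)) - 2 / 3 * (b * b * b - a * a * a)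
          = (b - a) ^ 2 * (b + 2 * a) / 3 := by ring
      have : 0 ≤ (b - a) ^ 2 * (b + 2 * a) / 3 := by positivity
      rw [h4] at e1
      linarith
    rw [← haa] at ih
    rw [← haa]
    have hb' : a * a + 1 = b * b := by linarith
    rw [hb']
    constructor
    · have := mul_le_mul_of_nonneg_left hhi h2
      linarith [ih.1]
    · have := mul_le_mul_of_nonneg_left hlo h2
      linarith [ih.2]

lemma one_le_optCoeff_succ (M : ℕ) : 1 ≤ optCoeff (M + 1) := by
  have h : 1 ≤ √(2 * ((M : ℝ) + 1)) :=
    Real.one_le_sqrt.2 (by linarith [(Nat.cast_nonneg M : (0 : ℝ) ≤ M)])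
  rw [optCoeff_succ]
  linarith [optCoeff_nonneg M]

/-- The limit of the ratio for `w → ∞` is `3 / (2 * √2)` up to an error of order `1 / √n`. -/
lemma abs_coeff_ratio_sub_le (M : ℕ) (hM : 1 ≤ M) :
    |((M : ℝ) + 1) * equilibriumCoeff M / optCoeff M - 3 / (2 * √2)|
      ≤ 27 / √((M : ℝ) + 1) := by
  have hM1 : (1 : ℝ) ≤ M := by exact_mod_cast hM
  obtain ⟨h1, h2⟩ := optCoeff_bounds M
  have h3 := abs_equilibriumCoeff_sub_sqrt_le M
  set c := equilibriumCoeff M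
  set τ := optCoeff M
  set b := √((M : ℝ) + 1) with hb
  set r := √(2 : ℝ) with hr
  have hr1 : 1 ≤ r := Real.one_le_sqrt.2 (by norm_num)
  have hrr : r * r = 2 := Real.mul_self_sqrt (by norm_num)
  have hbb : b * b = M + 1 := Real.mul_self_sqrt (by linarith)
  have hb1 : 1 ≤ b := Real.one_le_sqrt.2 (by linarith)
  rw [← hbb] at h1 h2 ⊢
  have hb2 : 2 ≤ b * b := by linarith
  have hτ : r * (b * b * b) / 6 ≤ τ := by
    have : b * b * b / 6 ≤ 2 / 3 * (b * b) * b - b := by nlinarith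
    have := mul_le_mul_of_nonneg_left this (zero_le_one.trans hr1)
    linarith
  have hb0 : 0 < b := by linarith
  have hr0 : 0 < r := by linarith
  have hτ0 : 0 < τ := lt_of_lt_of_le (by positivity) hτ
  have e : b * b * c / τ - 3 / (2 * r) = (2 * r * (b * b) * (c - b) + (2 * r * (b * b * b) - 3 * τ))
      / (2 * r * τ) := by
    field_simp
    ring
  rw [e, abs_div, abs_of_pos (show 0 < 2 * r * τ by positivity),
    div_le_div_iff₀ (by positivity) hb0]
  have h4 : |2 * r * (b * b) * (c - b) + (2 * r * (b * b * b) - 3 * τ)|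
      ≤ 9 * r * (b * b) := by
    refine (abs_add_le _ _).trans ?_
    have h5 : |2 * r * (b * b) * (c - b)| ≤ 2 * r * (b * b) * 3 := by
      rw [abs_mul, abs_of_pos (show 0 < 2 * r * (b * b) by positivity)]
      exact mul_le_mul_of_nonneg_left h3 (by positivity)
    have h6 : |2 * r * (b * b * b) - 3 * τ| ≤ 3 * r * b := by
      rw [abs_le]
      constructor <;> nlinarith
    have h7 : r * b ≤ r * (b * b) := by
      have := mul_le_mul_of_nonneg_left hb1 (mul_pos hr0 hb0).le
      linarith
    linarith
  have h8 := mul_le_mul_of_nonneg_right h4 hb0.le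
  have h9 := mul_le_mul_of_nonneg_left hτ (show 0 ≤ 54 * r by positivity)
  have h10 : 54 * r * (r * (b * b * b) / 6) = 9 * (r * r) * (b * b * b) := by ring
  rw [h10, hrr] at h9
  have h11 : r ≤ 2 := by nlinarith
  have h12 := mul_le_mul_of_nonneg_right h11 (show 0 ≤ 9 * (b * b * b) by positivity)
  linarith

/-! ### The price of anarchy -/

/-- Two costs of order `s` have almost the ratio of their coefficients if `s` is large. -/
lemma exists_abs_div_sub_div_le (x : ℝ) {τ : ℝ} (hτ : 0 < τ) (B D : ℝ) {ε : ℝ} (hε : 0 < ε) :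
    ∃ s₀ : ℝ, ∀ s : ℝ, s₀ < s → ∀ X O : ℝ, |X - x * s| ≤ B → |O - τ * s| ≤ D →
      0 < O ∧ |X / O - x / τ| ≤ ε := by
  refine ⟨max (2 * D / τ) (2 * (τ * B + |x| * D) / (τ * τ * ε)), fun s hs X O hX hO => ?_⟩
  obtain ⟨hs1, hs2⟩ := max_lt_iff.1 hs
  have hD0 : 0 ≤ D := (abs_nonneg _).trans hO
  have hs0 : 0 < s := lt_of_le_of_lt (by positivity) hs1
  rw [div_lt_iff₀ hτ] at hs1
  rw [div_lt_iff₀ (by positivity)] at hs2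
  have hO2 : τ * s / 2 ≤ O := by
    have := (abs_le.1 hO).1
    linarith
  have hO0 : 0 < O := lt_of_lt_of_le (by positivity) hO2
  refine ⟨hO0, ?_⟩
  have e : X / O - x / τ = (τ * (X - x * s) - x * (O - τ * s)) / (O * τ) := by
    field_simp
    ring
  rw [e, abs_div, abs_of_pos (mul_pos hO0 hτ), div_le_iff₀ (mul_pos hO0 hτ)]
  calc |τ * (X - x * s) - x * (O - τ * s)| ≤ |τ * (X - x * s)| + |x * (O - τ * s)| := abs_sub _ _
    _ = τ * |X - x * s| + |x| * |O - τ * s| := by rw [abs_mul, abs_mul, abs_of_pos hτ]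
    _ ≤ τ * B + |x| * D := add_le_add (mul_le_mul_of_nonneg_left hX hτ.le)
        (mul_le_mul_of_nonneg_left hO (abs_nonneg x))
    _ ≤ ε * (τ * s / 2 * τ) := by linarith
    _ ≤ ε * (O * τ) := mul_le_mul_of_nonneg_left (mul_le_mul_of_nonneg_right hO2 hτ.le) hε.le

lemma exists_OPT_bounds (M : ℕ) : ∃ D : ℝ, ∀ w : ℝ, 0 < w → 4 * (M : ℝ) ≤ √w →
    OPT (M + 1) w < ⊤ ∧ |(OPT (M + 1) w).toReal - optCoeff M * √w| ≤ D := by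
  obtain ⟨D, hD0, hD⟩ := exists_le_chainValue M
  refine ⟨max D (goodError M), fun w hw hMw => ?_⟩
  have hn : (M : ℝ) + 1 ≠ 0 := by positivity
  have hcast : ((M + 1 : ℕ) : ℝ≥0∞) = ENNReal.ofReal (M + 1) := by
    rw [← Nat.cast_succ, ENNReal.ofReal_natCast]
  have hlow : ENNReal.ofReal (optCoeff M * √w - D) ≤ OPT (M + 1) w := by
    refine le_iInf fun S => ?_
    rw [socialCost_symmetric S (M + 1) hw.le, Nat.add_sub_cancel, hcast]
    refine le_trans (le_of_eq ?_) (mul_le_mul_right (hD w S hw.le) _)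
    rw [← ENNReal.ofReal_mul (by positivity), mul_div_cancel₀ _ hn]
  have hup : OPT (M + 1) w ≤ ENNReal.ofReal (optCoeff M * √w + goodError M) := by
    refine (iInf_le _ (goodStrategy w)).trans ?_
    rw [socialCost_symmetric _ (M + 1) hw.le, Nat.add_sub_cancel, hcast]
    refine (mul_le_mul_right (chainValue_goodStrategy_le hw M hMw) _).trans (le_of_eq ?_)
    rw [← ENNReal.ofReal_mul (by positivity), goodBound, mul_div_cancel₀ _ hn]
  have htop : OPT (M + 1) w < ⊤ := hup.trans_lt ENNReal.ofReal_lt_top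
  have hnn : 0 ≤ optCoeff M * √w + goodError M :=
    add_nonneg (mul_nonneg (optCoeff_nonneg M) (Real.sqrt_nonneg w)) (goodError_nonneg M)
  refine ⟨htop, abs_le.2 ⟨?_, ?_⟩⟩
  · have := (ENNReal.ofReal_le_iff_le_toReal htop.ne).1 hlow
    linarith [le_max_left D (goodError M)]
  · have := ENNReal.toReal_le_of_le_ofReal hnn hup
    linarith [le_max_right D (goodError M)]

/-- The price of anarchy for a fixed number of agents and large `w`. -/
lemma exists_ratio_near (M : ℕ) (hM : 1 ≤ M) {ε : ℝ} (hε : 0 < ε) : ∃ W : ℝ, ∀ w : ℝ, W < w →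
    0 < OPT (M + 1) w ∧ OPT (M + 1) w < ⊤ ∧
    ∀ S : Strategy, IsSymmetricEquilibrium (M + 1) w S →
      socialCost (symmetric (M + 1) S) w < ⊤ ∧
      |(socialCost (symmetric (M + 1) S) w).toReal / (OPT (M + 1) w).toReal
        - ((M : ℝ) + 1) * equilibriumCoeff M / optCoeff M| ≤ ε := by
  have hτ : 0 < optCoeff M := by
    obtain ⟨M, rfl⟩ : ∃ M', M = M' + 1 := ⟨M - 1, by omega⟩
    exact zero_lt_one.trans_le (one_le_optCoeff_succ M)
  obtain ⟨D, hD⟩ := exists_OPT_bounds M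
  obtain ⟨B, hB⟩ := exists_abs_optValue_sub_le M
  obtain ⟨s₀, hs₀⟩ := exists_abs_div_sub_div_le (((M : ℝ) + 1) * equilibriumCoeff M) hτ
    ((M + 1) * max B 0) D hε
  refine ⟨max 16 (max (4 * (M : ℝ)) s₀ ^ 2), fun w hw => ?_⟩
  obtain ⟨hw1, hw2⟩ := max_lt_iff.1 hw
  have hw0 : 0 < w := by linarith
  obtain ⟨hs1, hs2⟩ := max_lt_iff.1 (Real.lt_sqrt_of_sq_lt hw2)
  obtain ⟨htop, hopt⟩ := hD w hw0 hs1.le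
  -- Positivity of the optimum must not presuppose an equilibrium, hence the comparison with the
  -- leading term itself.
  have hpos : 0 < (OPT (M + 1) w).toReal :=
    (hs₀ √w hs2 (((M : ℝ) + 1) * equilibriumCoeff M * √w) _
      (by rw [sub_self, abs_zero]; positivity) hopt).1
  refine ⟨(ENNReal.toReal_pos_iff.1 hpos).1, htop, fun S hS => ?_⟩
  have hval := chainValue_eq_of_isSymmetricEquilibrium (Nat.succ_pos M) hw1 hS (M := M)
    (Nat.succ_sub_one M).ge
  have hV0 := optValue_nonneg (S := S) hw0.le M 0
  have hsc : socialCost (symmetric (M + 1) S) w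
      = ENNReal.ofReal ((M + 1) * optValue S w M 0) := by
    rw [socialCost_symmetric S (M + 1) hw0.le, Nat.add_sub_cancel, hval,
      ENNReal.ofReal_mul (by positivity), ← Nat.cast_succ, ENNReal.ofReal_natCast]
  rw [hsc]
  refine ⟨ENNReal.ofReal_lt_top, ?_⟩
  rw [ENNReal.toReal_ofReal (by positivity)]
  refine (hs₀ √w hs2 _ _ ?_ hopt).2
  rw [mul_assoc, ← mul_sub, abs_mul, abs_of_pos (show (0 : ℝ) < M + 1 by positivity)]
  exact mul_le_mul_of_nonneg_left ((hB w S hw1 hval).trans (le_max_left B 0)) (by positivity)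

/-- The price of anarchy differs from `3 / (2 * √2)` by at most `28 / √n`. -/
lemma exists_abs_ratio_sub_le (n : ℕ) (hn : 2 ≤ n) : ∃ W : ℝ, ∀ w : ℝ, W < w →
    0 < OPT n w ∧ OPT n w < ⊤ ∧
    ∀ S : Strategy, IsSymmetricEquilibrium n w S →
      socialCost (symmetric n S) w < ⊤ ∧
      |(socialCost (symmetric n S) w).toReal / (OPT n w).toReal - 3 / (2 * √2)|
        ≤ 28 / √(n : ℝ) := by
  obtain ⟨M, rfl⟩ : ∃ M, n = M + 1 := ⟨n - 1, by omega⟩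
  have hsqrt : 0 < √((M + 1 : ℕ) : ℝ) := Real.sqrt_pos.2 (by positivity)
  obtain ⟨W, hW⟩ := exists_ratio_near M (by omega) (one_div_pos.2 hsqrt)
  refine ⟨W, fun w hw => ?_⟩
  obtain ⟨h0, htop, hS⟩ := hW w hw
  refine ⟨h0, htop, fun S hSe => ?_⟩
  obtain ⟨h1, h2⟩ := hS S hSe
  refine ⟨h1, (abs_sub_le _ (((M : ℝ) + 1) * equilibriumCoeff M / optCoeff M) _).trans ?_⟩
  have h3 := abs_coeff_ratio_sub_le M (by omega)
  rw [← Nat.cast_succ] at h2 h3 ⊢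
  refine (add_le_add h2 h3).trans (le_of_eq ?_)
  rw [← add_div]
  norm_num

end QueueGame

end

theorem theorem1p4 :
    (∃ K : ℝ, ∀ n : ℕ, 2 ≤ n → ∃ W : ℝ, ∀ w : ℝ, W < w →
      0 < QueueGame.OPT n w ∧ QueueGame.OPT n w < ⊤ ∧
      ∀ S : QueueGame.Strategy, QueueGame.IsSymmetricEquilibrium n w S →
        QueueGame.socialCost (QueueGame.symmetric n S) w < ⊤ ∧
        |(QueueGame.socialCost (QueueGame.symmetric n S) w).toReal / (QueueGame.OPT n w).toReal
            - 3 / (2 * Real.sqrt 2)| ≤ K / Real.sqrt (n : ℝ)) ∧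
    (∀ δ : ℝ, 0 < δ → ∃ n₀ : ℕ, ∀ n : ℕ, n₀ < n → ∃ W : ℝ, ∀ w : ℝ, W < w →
      0 < QueueGame.OPT n w ∧ QueueGame.OPT n w < ⊤ ∧
      ∀ S : QueueGame.Strategy, QueueGame.IsSymmetricEquilibrium n w S →
        QueueGame.socialCost (QueueGame.symmetric n S) w < ⊤ ∧
        (1 - δ) * (3 / (2 * Real.sqrt 2)) ≤
          (QueueGame.socialCost (QueueGame.symmetric n S) w).toReal / (QueueGame.OPT n w).toReal ∧
        (QueueGame.socialCost (QueueGame.symmetric n S) w).toReal / (QueueGame.OPT n w).toReal ≤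
          (1 + δ) * (3 / (2 * Real.sqrt 2))) := by
  refine ⟨⟨28, QueueGame.exists_abs_ratio_sub_le⟩, fun δ hδ => ?_⟩
  have hP : 0 < 3 / (2 * Real.sqrt 2) := by positivity
  obtain ⟨n₀, hn₀⟩ := exists_nat_gt ((28 / (δ * (3 / (2 * Real.sqrt 2)))) ^ 2)
  refine ⟨max n₀ 2, fun n hn => ?_⟩
  obtain ⟨hn1, hn2⟩ := max_lt_iff.1 hn
  obtain ⟨W, hW⟩ := QueueGame.exists_abs_ratio_sub_le n hn2.le
  refine ⟨W, fun w hw => ?_⟩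
  obtain ⟨h0, htop, hS⟩ := hW w hw
  refine ⟨h0, htop, fun S hSe => ?_⟩
  obtain ⟨h1, h2⟩ := hS S hSe
  have hsqrt : 28 / (δ * (3 / (2 * Real.sqrt 2))) < Real.sqrt n := by
    refine Real.lt_sqrt_of_sq_lt (hn₀.trans ?_)
    exact_mod_cast hn1
  have hle : 28 / Real.sqrt n ≤ δ * (3 / (2 * Real.sqrt 2)) := by
    have hpos : 0 < Real.sqrt n := lt_trans (by positivity) hsqrt
    rw [div_lt_iff₀ (by positivity)] at hsqrt
    rw [div_le_iff₀ hpos]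
    linarith
  obtain ⟨h3, h4⟩ := abs_le.1 (h2.trans hle)
  exact ⟨h1, by linarith, by linarith⟩
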